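/- Let $\mathbb{k}$ be a field of characteristic different from $2$, let $V$ be a finite-dimensional $\mathbb{k}$-vector space with basis $v_1,\dots,v_n$, and let $\mathbf q=(q_{ij})_{1\le i,j\le n}$ be nonzero scalars with $q_{ii}=1$ and $q_{ji}=q_{ij}^{-1}$. Let $$S_{\mathbf q}(V)=\mathbb{k}\langle v_1,\dots,v_n\mid v_iv_j=q_{ij}v_jv_i \text{ for all } i,j\rangle$$ be the quantum symmetric algebra. Let $G$ be a finite group acting linearly on $V$ (the action of $g$ on $v$ is written ${}^g v$) such that this action induces an action on $S_{\mathbf q}(V)$ by algebra automorphisms. Let $T(V)\# G$ be the skew group algebra of the tensor algebra $T(V)$: it is the free left $T(V)$-module with basis $\{t_g\mid g\in G\}$, with multiplication $(a\,t_g)(b\,t_h)=a\,({}^g b)\,t_{gh}$. Let $\kappa:V\times V\to(\mathbb{k}\oplus V)\otimes \mathbb{k}G$ be a bilinear map with $\kappa(v_i,v_j)=-q_{ij}\kappa(v_j,v_i)$ for all $i,j$, and write $$\kappa(v,w)=\sum_{g\in G}\bigl(\kappa_g^C(v,w)+\kappa_g^L(v,w)\bigr)t_g,\qquad \kappa_g^C(v,w)\in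 \mathbb{k},\quad \kappa_g^L(v,w)\in V.$$ Define $$\mathcal H_{\mathbf q,\kappa}=T(V)\# G\,/\,\bigl(v_iv_j-q_{ij}v_jv_i-\kappa(v_i,v_j)\mid 1\le i,j\le n\bigr),$$ the quotient by the two-sided ideal generated by the displayed elements. We call $\mathcal H_{\mathbf q,\kappa}$ a quantum Drinfeld orbifold algebra if it satisfies the PBW condition: the monomials $v_1^{m_1}\cdots v_n^{m_n}t_g$, indexed by $m_1,\dots,m_n\ge 0$ and $g\in G$, form a $\mathbb{k}$-basis of $\mathcal H_{\mathbf q,\kappa}$. For $g\in G$ define scalars $g_i^j$ by ${}^g v_j=\sum_{i=1}^n g_i^jv_i$, and put $\det_{ijkl}(g)=g_l^jg_k^i-q_{ji}\,g_l^ig_k^j$. **Theorem.** The algebra $\mathcal H_{\mathbf q,\kappa}$ is a quantum Drinfeld orbifold algebra if and only if the following conditions hold. (1) For all $g,h\in G$ and $1\le i<j\le n$, $$\kappa_g^C(v_j,v_i)=\sum_{k<l}\det\nolimits_{ijkl}(h)\,\kappa_{hgh^{-1}}^C(v_l,v_k)\quad\text{and}\quad {}^h\bigl(\kappa_g^L(v_j,v_i)\bigr)=\sum_{k<l}\det\nolimits_{ijkl}(h)\,\kappa_{hgh^{-1}}^L(v_l,v_k).$$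 Moreover, for all pairwise distinct indices $i,j,k$ and all $g\in G$: (2) in $S_{\mathbf q}(V)$, $$q_{ji}q_{ki}\,v_i\,\kappa_g^L(v_k,v_j)-\kappa_g^L(v_k,v_j)\,{}^gv_i-q_{kj}\,v_j\,\kappa_g^L(v_k,v_i)+q_{ji}\,\kappa_g^L(v_k,v_i)\,{}^gv_j+v_k\,\kappa_g^L(v_j,v_i)-q_{ki}q_{kj}\,\kappa_g^L(v_j,v_i)\,{}^gv_k=0;$$ (3) $$\begin{aligned}\sum_{h\in G}\Bigl\{&q_{ij}q_{ik}\,\kappa_{gh^{-1}}^L(\kappa_h^L(v_j,v_k),{}^hv_i)-\kappa_{gh^{-1}}^L(v_i,\kappa_h^L(v_j,v_k))+q_{ik}q_{jk}\,\kappa_{gh^{-1}}^L(\kappa_h^L(v_k,v_i),{}^hv_j)\\&-q_{ij}q_{ik}\,\kappa_{gh^{-1}}^L(v_j,\kappa_h^L(v_k,v_i))+\kappa_{gh^{-1}}^L(\kappa_h^L(v_i,v_j),{}^hv_k)-q_{ik}q_{jk}\,\kappa_{gh^{-1}}^L(v_k,\kappa_h^L(v_i,v_j))\Bigr\}\\ =2\Bigl\{&\kappa_g^C(v_j,v_k)(v_i-q_{ij}q_{ik}\,{}^gv_i)+\kappa_g^C(v_k,v_i)(q_{ij}q_{ik}v_j-q_{ik}q_{jk}\,{}^gv_j)+\kappa_g^C(v_i,v_j)(q_{ik}q_{jk}v_k-{}^gv_k)\Bigr\};\end{aligned}$$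 (4) $$\begin{aligned}\sum_{h\in G}\Bigl\{&q_{ij}q_{ik}\,\kappa_{gh^{-1}}^C(\kappa_h^L(v_j,v_k),{}^hv_i)-\kappa_{gh^{-1}}^C(v_i,\kappa_h^L(v_j,v_k))+q_{ik}q_{jk}\,\kappa_{gh^{-1}}^C(\kappa_h^L(v_k,v_i),{}^hv_j)\\&-q_{ij}q_{ik}\,\kappa_{gh^{-1}}^C(v_j,\kappa_h^L(v_k,v_i))+\kappa_{gh^{-1}}^C(\kappa_h^L(v_i,v_j),{}^hv_k)-q_{ik}q_{jk}\,\kappa_{gh^{-1}}^C(v_k,\kappa_h^L(v_i,v_j))\Bigr\}=0.\end{aligned}$$ -/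

import Mathlib

open scoped TensorProduct

noncomputable section

namespace QuantumDrinfeld

universe u v w

section Action

variable (k : Type u) {V : Type v} {G : Type w} [Field k] [AddCommGroup V] [Module k V]
  [Group G] [DistribMulAction G V] [SMulCommClass G k V]

/-- The algebra endomorphism of `T(V)` that extends the linear map `v ↦ g • v`. -/
def tensorAct (g : G) : TensorAlgebra k V →ₐ[k] TensorAlgebra k V :=
  TensorAlgebra.lift k ((TensorAlgebra.ι k).comp (DistribSMul.toLinearMap k V g))

theorem tensorAct_ι (g : G) (x : V) :
    tensorAct k g (TensorAlgebra.ι k x) = TensorAlgebra.ι k (g • x) := by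
  simp [tensorAct]

theorem tensorAct_one : tensorAct k (V := V) (1 : G) = AlgHom.id k _ := by
  ext x
  simp [tensorAct]

theorem tensorAct_mul (g h : G) :
    tensorAct k (V := V) (g * h) = (tensorAct k g).comp (tensorAct k h) := by
  ext x
  simp [tensorAct, mul_smul]

/-- A linear action of `G` on `V` extends to an action on `T(V)` by algebra automorphisms. -/
instance tensorAction : MulSemiringAction G (TensorAlgebra k V) where
  smul g x := tensorAct k g x
  one_smul x := by
    change tensorAct k (1 : G) x = x
    rw [tensorAct_one]; rfl
  mul_smul g h x := by
    change tensorAct k (g * h) x = tensorAct k g (tensorAct k h x)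
    rw [tensorAct_mul]; rfl
  smul_zero g := map_zero (tensorAct k g)
  smul_add g := map_add (tensorAct k g)
  smul_one g := map_one (tensorAct k g)
  smul_mul g := map_mul (tensorAct k g)

theorem smul_ι (g : G) (x : V) :
    g • TensorAlgebra.ι k x = TensorAlgebra.ι k (g • x) :=
  tensorAct_ι k g x

instance tensorAction_smulCommClass : SMulCommClass G k (TensorAlgebra k V) where
  smul_comm g c x := map_smul (tensorAct k g) c x

end Action

section QuantumSymmetric

variable {k : Type u} {V : Type v} [Field k] [AddCommGroup V] [Module k V] {n : ℕ}

/-- The relations `v_i v_j = q_{ij} v_j v_i` on `T(V) = k⟨v_1, …, v_n⟩`. -/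
inductive SymRel (b : Module.Basis (Fin n) k V) (q : Fin n → Fin n → k) :
    TensorAlgebra k V → TensorAlgebra k V → Prop
  | comm (i j : Fin n) : SymRel b q
      (TensorAlgebra.ι k (b i) * TensorAlgebra.ι k (b j))
      (q i j • (TensorAlgebra.ι k (b j) * TensorAlgebra.ι k (b i)))

/-- The quantum symmetric algebra `S_q(V)`. -/
abbrev QSym (b : Module.Basis (Fin n) k V) (q : Fin n → Fin n → k) : Type _ :=
  RingQuot (SymRel b q)

/-- The linear map `V → S_q(V)`. -/
def QSym.ι (b : Module.Basis (Fin n) k V) (q : Fin n → Fin n → k) : V →ₗ[k] QSym b q :=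
  (RingQuot.mkAlgHom k (SymRel b q)).toLinearMap.comp (TensorAlgebra.ι k)

/-- The linear action of `G` on `V` induces an action on `S_q(V)` by algebra automorphisms. -/
def ActsOnQSym (G : Type w) [Group G] [DistribMulAction G V]
    (b : Module.Basis (Fin n) k V) (q : Fin n → Fin n → k) : Prop :=
  ∃ Φ : G →* (QSym b q ≃ₐ[k] QSym b q), ∀ (g : G) (x : V),
    Φ g (QSym.ι b q x) = QSym.ι b q (g • x)

/-- The scalar `g_i^j`, determined by `g • v_j = ∑ i, g_i^j v_i`. -/
def coef {G : Type w} [Group G] [DistribMulAction G V] (b : Module.Basis (Fin n) k V)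
    (g : G) (j i : Fin n) : k :=
  b.repr (g • b j) i

/-- The quantum `(i,j,k,l)`-minor determinant `g_l^j g_k^i - q_{ji} g_l^i g_k^j`
(the third index is called `m` here, as `k` is the field). -/
def qdet {G : Type w} [Group G] [DistribMulAction G V] (b : Module.Basis (Fin n) k V)
    (q : Fin n → Fin n → k) (i j m l : Fin n) (g : G) : k :=
  coef b g j l * coef b g i m - q j i * (coef b g i l * coef b g j m)

end QuantumSymmetric

section Kappa

variable {k : Type u} {V : Type v} {G : Type w} [Field k] [AddCommGroup V] [Module k V]

/-- For `x = ∑ g, x_g ⊗ t_g` in `(k ⊕ V) ⊗ kG`, the component `x_g` in `k ⊕ V`. -/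
def component (g : G) : (k × V) ⊗[k] MonoidAlgebra k G →ₗ[k] k × V :=
  (TensorProduct.rid k (k × V)).toLinearMap.comp
    (LinearMap.lTensor (k × V)
      ((Finsupp.lapply g).comp (MonoidAlgebra.coeffLinearEquiv k).toLinearMap))

/-- The components do determine `x`, as `x = ∑ g, x_g ⊗ t_g`. -/
theorem sum_component [Fintype G] (x : (k × V) ⊗[k] MonoidAlgebra k G) :
    x = ∑ g : G, component g x ⊗ₜ[k] MonoidAlgebra.single g (1 : k) := by
  induction x with
  | zero => simp
  | add x y hx hy =>
    simp only [map_add, TensorProduct.add_tmul, Finset.sum_add_distrib]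
    exact congrArg₂ (· + ·) hx hy
  | tmul a f =>
    have : f = ∑ g : G, f.coeff g • MonoidAlgebra.single g (1 : k) := by
      ext h
      simp
    conv_lhs => rw [this]
    simp [TensorProduct.tmul_sum, component, TensorProduct.smul_tmul]

/-- The constant part `κ_g^C : V × V → k`. -/
def kappaC (κ : V →ₗ[k] V →ₗ[k] (k × V) ⊗[k] MonoidAlgebra k G) (g : G) (x y : V) : k :=
  (component g (κ x y)).1

/-- The linear part `κ_g^L : V × V → V`. -/
def kappaL (κ : V →ₗ[k] V →ₗ[k] (k × V) ⊗[k] MonoidAlgebra k G) (g : G) (x y : V) : V :=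
  (component g (κ x y)).2

variable [Group G] [Fintype G] [DistribMulAction G V] [SMulCommClass G k V]

/-- The skew group algebra `T(V) # G`, in which `(a # g) (b # h) = a (g • b) # gh`. -/
abbrev SkewTensor (k : Type u) (V : Type v) (G : Type w) [Field k] [AddCommGroup V] [Module k V] :
    Type _ :=
  SkewMonoidAlgebra (TensorAlgebra k V) G

/-- The inclusion `(k ⊕ V) ⊗ kG → T(V) # G`, which sends `(c + v) ⊗ t_g` to `(c + v) # g`. -/
def inclusion (x : (k × V) ⊗[k] MonoidAlgebra k G) : SkewTensor k V G :=
  ∑ g : G, SkewMonoidAlgebra.single g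
    (algebraMap k (TensorAlgebra k V) (component g x).1 + TensorAlgebra.ι k (component g x).2)

/-- A vector as an element of `T(V) # G`. -/
def vec (G : Type w) [Group G] (x : V) : SkewTensor k V G :=
  SkewMonoidAlgebra.single (1 : G) (TensorAlgebra.ι k x)

variable {n : ℕ}

/-- The relations `v_i v_j - q_{ij} v_j v_i - κ(v_i, v_j) = 0` on `T(V) # G`. -/
inductive HRel (b : Module.Basis (Fin n) k V) (q : Fin n → Fin n → k)
    (κ : V →ₗ[k] V →ₗ[k] (k × V) ⊗[k] MonoidAlgebra k G) :
    SkewTensor k V G → SkewTensor k V G → Prop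
  | rel (i j : Fin n) : HRel b q κ
      (vec G (b i) * vec G (b j) - q i j • (vec G (b j) * vec G (b i)) - inclusion (κ (b i) (b j)))
      0

/-- The algebra `H_{q,κ}`, the quotient of `T(V) # G` by the two-sided ideal generated by the
relations. -/
abbrev HAlg (b : Module.Basis (Fin n) k V) (q : Fin n → Fin n → k)
    (κ : V →ₗ[k] V →ₗ[k] (k × V) ⊗[k] MonoidAlgebra k G) : Type _ :=
  RingQuot (HRel b q κ)

/-- The image of the monomial `v_1^{m_1} ⋯ v_n^{m_n} t_g` in `H_{q,κ}`. -/
def HAlg.monomial (b : Module.Basis (Fin n) k V) (q : Fin n → Fin n → k)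
    (κ : V →ₗ[k] V →ₗ[k] (k × V) ⊗[k] MonoidAlgebra k G) (p : (Fin n → ℕ) × G) : HAlg b q κ :=
  RingQuot.mkAlgHom k (HRel b q κ)
    ((List.ofFn fun i => vec G (b i) ^ p.1 i).prod * SkewMonoidAlgebra.single p.2 1)

/-- `H_{q,κ}` is a quantum Drinfeld orbifold algebra, i.e. it satisfies the PBW condition: the
monomials `v_1^{m_1} ⋯ v_n^{m_n} t_g` form a basis over `k`. -/
def IsQuantumDrinfeldOrbifold (b : Module.Basis (Fin n) k V) (q : Fin n → Fin n → k)
    (κ : V →ₗ[k] V →ₗ[k] (k × V) ⊗[k] MonoidAlgebra k G) : Prop :=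
  LinearIndependent k (HAlg.monomial b q κ) ∧
    Submodule.span k (Set.range (HAlg.monomial b q κ)) = ⊤

end Kappa

end QuantumDrinfeld

end

/-!
The proof is a diamond lemma argument over the group. The elements `w t_g`, where `w` is a word in
the basis vectors, form a basis of `A = T(V) # G`, and each relation is read as a rule that rewrites
a descent `v_j v_i`, `i < j`, inside such an element as `q_{ji} v_i v_j + κ(v_j, v_i)`. Rules
decrease the pair (length, number of inversions), and the irreducible elements are exactly the PBW
monomials. Over a field the diamond lemma is a statement about a basis with well-founded rules
(`exists_reduction`, `span_irreducible`): if the difference of two rules at the same element lies in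
the span of the rules at smaller elements, the irreducible elements form a basis of the quotient.

The conditions are best expressed on `V ⊗ V`. Let `σ` be the quantum flip
`v_i ⊗ v_j ↦ q_{ij} v_j ⊗ v_i` (`qswap`) and `Λ = {X | σ X = -X}` (`qext`). Since `2` is invertible,
`Λ` is the space of quadratic relations of `S_q(V)` (`mulS_eq_zero_iff`). As `κ ∘ σ = -κ`, the
relation of `H` attached to `X ∈ Λ` is `2 X - κ(X)` (`rel_of_mem_qext`), which is the origin of the
factor `2` in the Jacobi identity.

* The action on `S_q(V)` makes `Λ` stable under `G` (`preservesQExt_of_actsOnQSym`). Hence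
  conjugation by `t_h` preserves the span of the relations exactly when
  `κ_{hgh⁻¹}(h X) = h κ_g(X)` for `X ∈ Λ` (`KappaInvariant`), which in coordinates is the condition
  with quantum minors. This resolves disjoint descents, where a group element produced by one rule
  has to move across the other relation.
* For an overlap `v_m v_j v_i`, the two reductions differ by `∑ g, (X_g + Y_g) t_g` with
  `X_g ∈ V ⊗ V` (`overlapQuad`) and `Y_g ∈ k ⊕ V` (`overlapLin`), see `rel_mul_vec_sub`. It reduces
  to zero exactly when `X_g ∈ Λ` and, after rewriting `2 X_g` as `κ(X_g)`,
  `∑ h, κ_{gh⁻¹}(X_h) + 2 Y_g = 0` (`two_smul_overlap`). These are the quantum commutation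
  condition and the two Jacobi-type conditions.

Conversely, all these differences vanish in `H`, and under the PBW property an element of degree
at most two vanishes only if its quadratic part lies in `Λ` and the rest is zero (`mem_qext_of_toH`,
`eq_zero_of_toH_low`), so the conditions are necessary. The description of the quadratic relations
of `S_q(V)` itself uses the sufficiency part for the trivial group and `κ = 0`.
-/

noncomputable section

namespace QuantumDrinfeld

set_option linter.unusedSectionVars false

universe u v w

/-! ### A linear form of the diamond lemma -/

section Diamond

variable {k A X ρ : Type*} [Field k] [AddCommGroup A] [Module k A]

/-- The diamond lemma. A rule `r` rewrites `B (lhs r)` as `B (lhs r) - δ r`, a combination of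
smaller basis vectors. If two rules at the same basis vector always differ by a combination of rules
at smaller ones, there is a linear reduction to normal form that kills every `δ r` and fixes the
irreducible basis vectors. -/
theorem exists_reduction [LT X] [WellFoundedLT X] (B : Module.Basis X k A) (lhs : ρ → X)
    (δ : ρ → A)
    (hlow : ∀ r, B (lhs r) - δ r ∈ Submodule.span k (B '' {y | y < lhs r}))
    (hconf : ∀ r s, lhs r = lhs s → δ r - δ s ∈ Submodule.span k (δ '' {t | lhs t < lhs r})) :
    ∃ L : A →ₗ[k] A, (∀ r, L (δ r) = 0) ∧ ∀ x, x ∉ Set.range lhs → L (B x) = B x := by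
  classical
  -- Well-founded recursion with one chosen rule at each reducible `x`. The test `y < x` always
  -- succeeds by `hlow`; it only serves to make the recursive call legal.
  let F : ∀ x, (∀ y, y < x → A) → A := fun x rec =>
    if h : ∃ r, lhs r = x then
      (B.repr (B x - δ h.choose)).sum fun y c => c • (if hy : y < x then rec y hy else 0)
    else B x
  let val : X → A := (wellFounded_lt (α := X)).fix F
  have hval : ∀ x, val x = F x fun y _ => val y := fun x => WellFounded.fix_eq _ F x
  let L : A →ₗ[k] A := B.constr k val
  have hL : ∀ x, L (B x) = val x := fun x => B.constr_basis k val x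
  refine ⟨L, ?_, ?_⟩
  · have key : ∀ x, ∀ r, lhs r = x → L (δ r) = 0 := by
      intro x
      induction x using (wellFounded_lt (α := X)).induction with
      | _ x ih =>
        intro r hr
        have h : ∃ r, lhs r = x := ⟨r, hr⟩
        have h1 : L (δ h.choose) = 0 := by
          have hc := h.choose_spec
          have hs := hlow h.choose
          rw [hc] at hs
          have hs' : (↑(B.repr (B x - δ h.choose)).support : Set X) ⊆ {y | y < x} :=
            (Module.Basis.mem_span_image B).1 hs
          have e1 : L (B x) = L (B x - δ h.choose) := by
            conv_rhs => rw [← B.linearCombination_repr (B x - δ h.choose)]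
            rw [hL, hval, Finsupp.linearCombination_apply, Finsupp.sum, map_sum]
            simp only [F, dif_pos h, Finsupp.sum]
            refine Finset.sum_congr rfl fun y hy => ?_
            have hyx : y < x := hs' hy
            rw [dif_pos hyx, map_smul, hL]
          rw [map_sub] at e1
          exact sub_eq_self.1 e1.symm
        have h2 : δ r - δ h.choose ∈ LinearMap.ker L := by
          have := hconf r h.choose (hr.trans h.choose_spec.symm)
          refine Submodule.span_le.2 ?_ this
          rintro _ ⟨t, ht, rfl⟩
          exact ih (lhs t) (hr ▸ ht) t rfl
        rw [LinearMap.mem_ker, map_sub, h1, sub_zero] at h2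
        exact h2
    exact fun r => key _ r rfl
  · intro x hx
    rw [hL, hval]
    exact dif_neg hx

/-- Irreducible basis vectors span modulo the rules; no confluence is needed. -/
theorem span_irreducible [LT X] [WellFoundedLT X] (B : Module.Basis X k A) (lhs : ρ → X)
    (δ : ρ → A)
    (hlow : ∀ r, B (lhs r) - δ r ∈ Submodule.span k (B '' {y | y < lhs r})) :
    Submodule.span k (B '' (Set.range lhs)ᶜ) ⊔ Submodule.span k (Set.range δ) = ⊤ := by
  rw [eq_top_iff, ← B.span_eq, Submodule.span_le]
  rintro _ ⟨x, rfl⟩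
  induction x using (wellFounded_lt (α := X)).induction with
  | _ x ih =>
    by_cases hx : x ∈ Set.range lhs
    · obtain ⟨r, rfl⟩ := hx
      have h1 : B (lhs r) - δ r ∈
          Submodule.span k (B '' (Set.range lhs)ᶜ) ⊔ Submodule.span k (Set.range δ) := by
        refine Submodule.span_le.2 ?_ (hlow r)
        rintro _ ⟨y, hy, rfl⟩
        exact ih y hy
      have h2 := Submodule.add_mem _ h1
        (Submodule.mem_sup_right (Submodule.subset_span (Set.mem_range_self r)))
      simpa using h2
    · exact Submodule.mem_sup_left (Submodule.subset_span ⟨x, hx, rfl⟩)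

end Diamond

/-! ### Words and inversions -/

section Words

variable {n : ℕ}

/-- The number of inversions of a word: pairs of positions whose letters decrease. -/
def inversions : List (Fin n) → ℕ
  | [] => 0
  | a :: l => l.countP (· < a) + inversions l

theorem inversions_swap_lt {i j : Fin n} (h : i < j) (u w : List (Fin n)) :
    inversions (u ++ i :: j :: w) < inversions (u ++ j :: i :: w) := by
  induction u with
  | nil =>
    have h' : ¬ j < i := not_lt.2 h.le
    simp [inversions, h, h']
    omega
  | cons a u ih =>
    have : (u ++ i :: j :: w).countP (· < a) = (u ++ j :: i :: w).countP (· < a) :=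
      ((List.Perm.swap j i w).append_left u).countP_eq _
    simp only [List.cons_append, inversions, this]
    omega

/-- A word together with a group element; the indices of the monomial basis of `T(V) # G`. -/
@[ext] structure GWord (n : ℕ) (G : Type*) where
  /-- The word in the basis vectors. -/
  word : List (Fin n)
  /-- The group element. -/
  grp : G

/-- `GWord` as a pair, in the order used by `Finsupp.basis`. -/
def GWord.equiv (n : ℕ) (G : Type*) : (Σ _ : G, FreeMonoid (Fin n)) ≃ GWord n G where
  toFun x := ⟨x.2.toList, x.1⟩
  invFun x := ⟨x.grp, FreeMonoid.ofList x.word⟩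
  left_inv _ := rfl
  right_inv _ := rfl

/-- Words are compared by length, and words of equal length by the number of inversions. -/
instance (G : Type*) : LT (GWord n G) where
  lt x y := Prod.Lex (· < ·) (· < ·) (x.word.length, inversions x.word)
    (y.word.length, inversions y.word)

theorem GWord.lt_iff {G : Type*} {x y : GWord n G} : x < y ↔ x.word.length < y.word.length ∨
    x.word.length = y.word.length ∧ inversions x.word < inversions y.word :=
  Prod.lex_def

instance (G : Type*) : WellFoundedLT (GWord n G) where
  wf := InvImage.wf (fun x : GWord n G => (x.word.length, inversions x.word))
    (WellFounded.prod_lex wellFounded_lt wellFounded_lt)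

theorem GWord.trans {G : Type*} {x y z : GWord n G} (h : x < y) (h' : y < z) : x < z := by
  rw [GWord.lt_iff] at *
  omega

theorem GWord.swap_lt {G : Type*} {i j : Fin n} (h : i < j) (u w : List (Fin n)) (g g' : G) :
    (⟨u ++ i :: j :: w, g⟩ : GWord n G) < ⟨u ++ j :: i :: w, g'⟩ :=
  GWord.lt_iff.2 (.inr ⟨by simp, inversions_swap_lt h u w⟩)

/-- The weakly increasing word with `m i` letters `i`. -/
def sortedWord (m : Fin n → ℕ) : List (Fin n) :=
  (List.ofFn fun i => List.replicate (m i) i).flatten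

theorem sortedWord_pairwise (m : Fin n → ℕ) : (sortedWord m).Pairwise (· ≤ ·) := by
  rw [sortedWord, List.pairwise_flatten]
  constructor
  · intro l hl
    obtain ⟨i, rfl⟩ := (List.mem_ofFn' _ _).1 hl
    exact List.pairwise_replicate_of_refl
  · rw [List.pairwise_ofFn]
    intro i j hij x hx y hy
    rw [List.eq_of_mem_replicate hx, List.eq_of_mem_replicate hy]
    exact hij.le

theorem count_sortedWord (m : Fin n → ℕ) (i : Fin n) : (sortedWord m).count i = m i := by
  rw [sortedWord, List.count_flatten, List.map_ofFn, List.sum_ofFn]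
  simp [List.count_replicate]

theorem sortedWord_injective : Function.Injective (sortedWord (n := n)) := by
  intro m m' h
  ext i
  rw [← count_sortedWord m i, h, count_sortedWord]

/-- A weakly increasing word is determined by its letter counts. -/
theorem sortedWord_count {l : List (Fin n)} (h : l.Pairwise (· ≤ ·)) :
    sortedWord (fun i => l.count i) = l := by
  refine List.Perm.eq_of_pairwise' (sortedWord_pairwise _) h (List.perm_iff_count.2 fun i => ?_)
  rw [count_sortedWord]

/-- A word without a descent at adjacent letters is weakly increasing. -/
theorem pairwise_of_no_descent {l : List (Fin n)}
    (h : ∀ u i j w, i < j → l ≠ u ++ j :: i :: w) : l.Pairwise (· ≤ ·) := by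
  rw [← List.isChain_iff_pairwise, List.isChain_iff_forall_rel_of_append_cons_cons]
  intro a c u w e
  exact not_lt.1 fun hlt => h u c a w hlt e

end Words

/-! ### The skew group algebra -/

section Skew

variable {k : Type u} {V : Type v} {G : Type w} [Field k] [AddCommGroup V] [Module k V]
  [Group G] [DistribMulAction G V] [SMulCommClass G k V] {n : ℕ}

/-- The group element `t_g` of `T(V) # G`. -/
def grp (k : Type u) (V : Type v) {G : Type w} [Field k] [AddCommGroup V] [Module k V]
    (g : G) : SkewTensor k V G :=
  SkewMonoidAlgebra.single g 1

variable (k V) in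
theorem grp_mul (g h : G) : grp k V g * grp k V h = grp k V (g * h) := by
  simp [grp, SkewMonoidAlgebra.single_mul_single]

variable (k V) in
@[simp] theorem grp_one : grp k V (1 : G) = 1 := rfl

theorem grp_mul_vec (g : G) (x : V) :
    grp k V g * vec G x = vec G (g • x) * grp k V g := by
  simp [grp, vec, SkewMonoidAlgebra.single_mul_single, smul_ι]

/-- The linear map `V → T(V) # G`. -/
def vecL (k : Type u) (V : Type v) (G : Type w) [Field k] [AddCommGroup V] [Module k V]
    [Group G] [DistribMulAction G V] [SMulCommClass G k V] : V →ₗ[k] SkewTensor k V G where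
  toFun := vec G
  map_add' x y := by simp [vec, SkewMonoidAlgebra.single_add]
  map_smul' c x := by simp [vec, SkewMonoidAlgebra.smul_single]

@[simp] theorem vecL_apply (x : V) : vecL k V G x = vec G x := rfl

/-- The inclusion of `k ⊕ V` in `T(V) # G`. -/
def low (G : Type w) [Group G] [DistribMulAction G V] [SMulCommClass G k V] :
    k × V →ₗ[k] SkewTensor k V G :=
  (Algebra.linearMap k (SkewTensor k V G)).coprod (vecL k V G)

theorem low_apply (y : k × V) :
    low G y = algebraMap k (SkewTensor k V G) y.1 + vec G y.2 := rfl

/-- The action of `G` on `k ⊕ V` that is trivial on `k`. -/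
def actLow (k : Type u) (V : Type v) {G : Type w} [Field k] [AddCommGroup V] [Module k V]
    [Group G] [DistribMulAction G V] [SMulCommClass G k V] (h : G) : k × V →ₗ[k] k × V :=
  LinearMap.id.prodMap (DistribSMul.toLinearMap k V h)

@[simp] theorem actLow_apply (h : G) (y : k × V) : actLow k V h y = (y.1, h • y.2) := rfl

theorem grp_mul_low (h : G) (y : k × V) :
    grp k V h * low G y = low G (actLow k V h y) * grp k V h := by
  rw [low_apply, low_apply, mul_add, add_mul, grp_mul_vec, Algebra.commutes]
  rfl

/-- Multiplication `V ⊗ V → T(V) # G`. -/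
def mulT (k : Type u) (V : Type v) (G : Type w) [Field k] [AddCommGroup V] [Module k V]
    [Group G] [DistribMulAction G V] [SMulCommClass G k V] :
    V ⊗[k] V →ₗ[k] SkewTensor k V G :=
  TensorProduct.lift ((LinearMap.mul k (SkewTensor k V G)).compl₁₂ (vecL k V G) (vecL k V G))

@[simp] theorem mulT_tmul (x y : V) : mulT k V G (x ⊗ₜ y) = vec G x * vec G y := rfl

/-- The diagonal action of `G` on `V ⊗ V`. -/
def actT (k : Type u) (V : Type v) {G : Type w} [Field k] [AddCommGroup V] [Module k V]
    [Group G] [DistribMulAction G V] [SMulCommClass G k V] (h : G) :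
    V ⊗[k] V →ₗ[k] V ⊗[k] V :=
  TensorProduct.map (DistribSMul.toLinearMap k V h) (DistribSMul.toLinearMap k V h)

@[simp] theorem actT_tmul (h : G) (x y : V) :
    actT k V h (x ⊗ₜ y) = (h • x) ⊗ₜ (h • y) := rfl

theorem grp_mul_mulT (h : G) (X : V ⊗[k] V) :
    grp k V h * mulT k V G X = mulT k V G (actT k V h X) * grp k V h := by
  induction X with
  | zero => simp
  | add X Y hX hY => simp only [map_add, mul_add, add_mul, hX, hY]
  | tmul x y =>
    simp only [mulT_tmul, actT_tmul]
    rw [← mul_assoc, grp_mul_vec, mul_assoc, grp_mul_vec, mul_assoc]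

section Inclusion

variable [Fintype G]

theorem inclusion_eq (x : (k × V) ⊗[k] MonoidAlgebra k G) :
    inclusion x = ∑ g : G, low G (component g x) * grp k V g := by
  refine Finset.sum_congr rfl fun g _ => ?_
  rw [low_apply, grp, vec, SkewMonoidAlgebra.coe_algebraMap]
  simp [SkewMonoidAlgebra.single_mul_single, ← SkewMonoidAlgebra.single_add]

/-- `inclusion` as a linear map. -/
def incL (k : Type u) (V : Type v) (G : Type w) [Field k] [AddCommGroup V] [Module k V]
    [Group G] [Fintype G] [DistribMulAction G V] [SMulCommClass G k V] :
    (k × V) ⊗[k] MonoidAlgebra k G →ₗ[k] SkewTensor k V G where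
  toFun := inclusion
  map_add' x y := by simp [inclusion_eq, add_mul, Finset.sum_add_distrib]
  map_smul' c x := by simp [inclusion_eq, Finset.smul_sum]

theorem incL_apply (x : (k × V) ⊗[k] MonoidAlgebra k G) :
    incL k V G x = ∑ g : G, low G (component g x) * grp k V g := inclusion_eq x

end Inclusion

/-! ### The monomial basis of the skew group algebra -/

/-- The product of the basis vectors named by a word, in `T(V) # G`. -/
def mon (G : Type w) [Group G] [DistribMulAction G V] [SMulCommClass G k V]
    (b : Module.Basis (Fin n) k V) (w : List (Fin n)) : SkewTensor k V G :=
  (w.map fun i => vec G (b i)).prod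

variable (b : Module.Basis (Fin n) k V)

@[simp] theorem mon_nil : mon G b [] = 1 := rfl

@[simp] theorem mon_cons (i : Fin n) (w : List (Fin n)) :
    mon G b (i :: w) = vec G (b i) * mon G b w := by simp [mon]

@[simp] theorem mon_append (u w : List (Fin n)) : mon G b (u ++ w) = mon G b u * mon G b w := by
  simp [mon]

theorem mon_eq_single (w : List (Fin n)) :
    mon G b w =
      SkewMonoidAlgebra.single 1 ((w.map fun i => TensorAlgebra.ι k (b i)).prod) := by
  induction w with
  | nil => rfl
  | cons i w ih =>
    rw [mon_cons, ih, vec, SkewMonoidAlgebra.single_mul_single]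
    simp

/-- The basis of `T(V) # G` that consists of the products of a word and a group element. -/
def wordBasis (G : Type w) [Group G] [DistribMulAction G V] [SMulCommClass G k V]
    (b : Module.Basis (Fin n) k V) : Module.Basis (GWord n G) k (SkewTensor k V G) :=
  ((Finsupp.basis fun _ : G => b.tensorAlgebra).map
    SkewMonoidAlgebra.coeffLinearEquiv.symm).reindex (GWord.equiv n G)

theorem tensorAlgebra_basis_apply (w : List (Fin n)) :
    b.tensorAlgebra (FreeMonoid.ofList w) = (w.map fun i => TensorAlgebra.ι k (b i)).prod := by
  have h : b.tensorAlgebra (FreeMonoid.ofList w) = (TensorAlgebra.equivFreeAlgebra b).symm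
      (FreeAlgebra.equivMonoidAlgebraFreeMonoid.symm
        (MonoidAlgebra.single (FreeMonoid.ofList w) (1 : k))) := rfl
  rw [h, FreeAlgebra.equivMonoidAlgebraFreeMonoid, AlgEquiv.ofAlgHom_symm]
  simp [MonoidAlgebra.lift_single, FreeMonoid.lift_apply,
    map_list_prod]
  congr 1
  exact List.map_congr_left fun i _ => TensorAlgebra.equivFreeAlgebra_symm_ι b i

theorem wordBasis_apply (x : GWord n G) :
    wordBasis G b x = mon G b x.word * grp k V x.grp := by
  rw [mon_eq_single, grp, SkewMonoidAlgebra.single_mul_single, ← tensorAlgebra_basis_apply]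
  rw [wordBasis, Module.Basis.reindex_apply, Module.Basis.map_apply, Finsupp.coe_basis]
  simp
  rfl

end Skew

/-! ### The quantum exterior square -/

section Swap

variable {k : Type u} {V : Type v} [Field k] [AddCommGroup V] [Module k V] {n : ℕ}
  (b : Module.Basis (Fin n) k V) (q : Fin n → Fin n → k)

/-- The quantum flip `v_i ⊗ v_j ↦ q_{ij} v_j ⊗ v_i` of `V ⊗ V`. -/
def qswap : V ⊗[k] V →ₗ[k] V ⊗[k] V :=
  (b.tensorProduct b).constr k fun p => q p.1 p.2 • b p.2 ⊗ₜ[k] b p.1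

@[simp] theorem qswap_basis (i j : Fin n) :
    qswap b q (b i ⊗ₜ b j) = q i j • b j ⊗ₜ[k] b i := by
  rw [← Module.Basis.tensorProduct_apply, qswap, Module.Basis.constr_basis]

theorem tensor_hom_ext {M : Type*} [AddCommMonoid M] [Module k M] {f g : V ⊗[k] V →ₗ[k] M}
    (h : ∀ i j, f (b i ⊗ₜ b j) = g (b i ⊗ₜ b j)) : f = g :=
  (b.tensorProduct b).ext fun p => by
    rw [Module.Basis.tensorProduct_apply]
    exact h p.1 p.2

variable {q} in
theorem qswap_qswap (hq : ∀ i j, q i j * q j i = 1) (X : V ⊗[k] V) :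
    qswap b q (qswap b q X) = X := by
  have : (qswap b q).comp (qswap b q) = LinearMap.id := tensor_hom_ext b fun i j => by
    simp [smul_smul, hq]
  exact LinearMap.congr_fun this X

/-- The quantum antisymmetric tensors, on which the quantum flip is `-1`. These are the
relations of the quantum symmetric algebra. -/
def qext : Submodule k (V ⊗[k] V) := LinearMap.ker (qswap b q + LinearMap.id)

variable {b q}

theorem mem_qext {X : V ⊗[k] V} : X ∈ qext b q ↔ qswap b q X = -X := by
  simp [qext, eq_neg_iff_add_eq_zero]

theorem sub_qswap_mem_qext (hq : ∀ i j, q i j * q j i = 1) (X : V ⊗[k] V) :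
    X - qswap b q X ∈ qext b q := by
  rw [mem_qext, map_sub, qswap_qswap b hq, neg_sub]

end Swap

section Rel

variable {k : Type u} {V : Type v} {G : Type w} [Field k] [AddCommGroup V] [Module k V]
  {n : ℕ}

/-- The map `κ_g` on `V ⊗ V`, with values in `k ⊕ V`. -/
def kap (κ : V →ₗ[k] V →ₗ[k] (k × V) ⊗[k] MonoidAlgebra k G) (g : G) :
    V ⊗[k] V →ₗ[k] k × V :=
  (component g).comp (TensorProduct.lift κ)

@[simp] theorem kap_tmul (κ : V →ₗ[k] V →ₗ[k] (k × V) ⊗[k] MonoidAlgebra k G) (g : G) (x y : V) :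
    kap κ g (x ⊗ₜ y) = (kappaC κ g x y, kappaL κ g x y) := rfl

variable {b : Module.Basis (Fin n) k V} {q : Fin n → Fin n → k}
  {κ : V →ₗ[k] V →ₗ[k] (k × V) ⊗[k] MonoidAlgebra k G}

theorem lift_qswap (hκ : ∀ i j, κ (b i) (b j) = -(q i j • κ (b j) (b i))) (X : V ⊗[k] V) :
    TensorProduct.lift κ (qswap b q X) = -TensorProduct.lift κ X := by
  have : (TensorProduct.lift κ).comp (qswap b q) = -TensorProduct.lift κ :=
    tensor_hom_ext b fun i j => by
      simp [hκ i j]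
  exact LinearMap.congr_fun this X

theorem kap_qswap (hκ : ∀ i j, κ (b i) (b j) = -(q i j • κ (b j) (b i))) (g : G) (X : V ⊗[k] V) :
    kap κ g (qswap b q X) = -kap κ g X := by
  simp [kap, lift_qswap hκ]

variable [Group G] [DistribMulAction G V] [SMulCommClass G k V]

/-! ### Filtrations of the skew group algebra -/

theorem vec_eq_sum (b : Module.Basis (Fin n) k V) (x : V) :
    (vec G x : SkewTensor k V G) = ∑ i, b.repr x i • vec G (b i) := by
  conv_lhs => rw [← b.sum_repr x, ← vecL_apply, map_sum]
  simp

variable (b) (G) in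
/-- The elements of `T(V) # G` of degree at most `d`. -/
def degLE (d : ℕ) : Submodule k (SkewTensor k V G) :=
  Submodule.span k {a | ∃ (w : List (Fin n)) (g : G), w.length ≤ d ∧ a = mon G b w * grp k V g}

theorem degLE_mono : Monotone (degLE G b) := fun _ _ h =>
  Submodule.span_mono fun _ ⟨w, g, hw, e⟩ => ⟨w, g, hw.trans h, e⟩

/-- If a linear map sends a spanning set into a submodule, it sends the span there. -/
theorem map_mem_of_span {A : Type*} [AddCommGroup A] [Module k A] {s : Set A} {S : Submodule k A}
    (f : A →ₗ[k] A) (h : ∀ a ∈ s, f a ∈ S) {a : A} (ha : a ∈ Submodule.span k s) : f a ∈ S :=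
  (Submodule.span_le (p := S.comap f)).2 h ha

theorem mul_vec_mem_degLE {d : ℕ} {a : SkewTensor k V G} (ha : a ∈ degLE G b d) (x : V) :
    a * vec G x ∈ degLE G b (d + 1) := by
  refine map_mem_of_span (LinearMap.mulRight k (vec G x)) ?_ ha
  rintro _ ⟨w, g, hw, rfl⟩
  rw [LinearMap.mulRight_apply, mul_assoc, grp_mul_vec, vec_eq_sum b, Finset.sum_mul,
    Finset.mul_sum]
  refine Submodule.sum_mem _ fun i _ => ?_
  rw [smul_mul_assoc, mul_smul_comm, ← mul_assoc]
  refine Submodule.smul_mem _ _ (Submodule.subset_span ⟨w ++ [i], g, by simpa using hw, ?_⟩)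
  simp

theorem mul_grp_mem_degLE {d : ℕ} {a : SkewTensor k V G} (ha : a ∈ degLE G b d) (h : G) :
    a * grp k V h ∈ degLE G b d := by
  refine map_mem_of_span (LinearMap.mulRight k (grp k V h)) ?_ ha
  rintro _ ⟨w, g, hw, rfl⟩
  rw [LinearMap.mulRight_apply, mul_assoc, grp_mul]
  exact Submodule.subset_span ⟨w, _, hw, rfl⟩

theorem mon_mem_degLE (w : List (Fin n)) : mon G b w ∈ degLE G b w.length :=
  Submodule.subset_span ⟨w, 1, le_rfl, by rw [grp_one, mul_one]⟩

theorem mul_mon_mem_degLE {d : ℕ} {a : SkewTensor k V G} (ha : a ∈ degLE G b d)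
    (w : List (Fin n)) : a * mon G b w ∈ degLE G b (d + w.length) := by
  induction w generalizing a d with
  | nil => simpa using ha
  | cons i w ih =>
    rw [mon_cons, ← mul_assoc]
    have := ih (mul_vec_mem_degLE ha (b i))
    rwa [List.length_cons, ← add_assoc, add_right_comm]

theorem mul_low_mem_degLE {d : ℕ} {a : SkewTensor k V G} (ha : a ∈ degLE G b d) (y : k × V) :
    a * low G y ∈ degLE G b (d + 1) := by
  rw [low_apply, mul_add, ← Algebra.commutes, ← Algebra.smul_def]
  exact add_mem (Submodule.smul_mem _ _ (degLE_mono (Nat.le_succ d) ha)) (mul_vec_mem_degLE ha _)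

/-! ### The defining relations -/

variable [Fintype G]

variable (b q κ) in
/-- The relation of `H_{q,κ}` attached to a tensor; on `v_i ⊗ v_j` it is
`v_i v_j - q_{ij} v_j v_i - κ(v_i, v_j)`. -/
def rel : V ⊗[k] V →ₗ[k] SkewTensor k V G :=
  mulT k V G - (mulT k V G).comp (qswap b q) - (incL k V G).comp (TensorProduct.lift κ)

theorem rel_apply (X : V ⊗[k] V) : rel b q κ X =
    mulT k V G X - mulT k V G (qswap b q X) - ∑ g : G, low G (kap κ g X) * grp k V g := by
  rw [rel, LinearMap.sub_apply, LinearMap.sub_apply, LinearMap.comp_apply, LinearMap.comp_apply,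
    incL_apply]
  rfl

theorem rel_basis (i j : Fin n) : rel b q κ (b i ⊗ₜ b j) =
    vec G (b i) * vec G (b j) - q i j • (vec G (b j) * vec G (b i)) - inclusion (κ (b i) (b j)) := by
  simp [rel]
  rfl

theorem rel_of_mem_qext {X : V ⊗[k] V} (hX : X ∈ qext b q) : rel b q κ X =
    (2 : k) • mulT k V G X - ∑ g : G, low G (kap κ g X) * grp k V g := by
  rw [rel_apply, mem_qext.1 hX, map_neg, sub_neg_eq_add, two_smul]

theorem rel_qswap (hq : ∀ i j, q i j * q j i = 1)
    (hκ : ∀ i j, κ (b i) (b j) = -(q i j • κ (b j) (b i))) (X : V ⊗[k] V) :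
    rel b q κ (qswap b q X) = -rel b q κ X := by
  simp only [rel, LinearMap.sub_apply, LinearMap.comp_apply, qswap_qswap b hq, lift_qswap hκ,
    map_neg]
  abel

/-- The relation of `X` depends only on the quantum antisymmetric part of `X`. -/
theorem rel_eq_half (h2 : (2 : k) ≠ 0) (hq : ∀ i j, q i j * q j i = 1)
    (hκ : ∀ i j, κ (b i) (b j) = -(q i j • κ (b j) (b i))) (X : V ⊗[k] V) :
    rel b q κ X = (2 : k)⁻¹ • rel b q κ (X - qswap b q X) := by
  rw [map_sub, rel_qswap hq hκ, sub_neg_eq_add, ← two_smul k, smul_smul, inv_mul_cancel₀ h2,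
    one_smul]

variable (G b q) in
/-- The action of `G` on `V ⊗ V` preserves the quantum antisymmetric tensors. -/
def PreservesQExt : Prop := ∀ (h : G) (X : V ⊗[k] V), X ∈ qext b q → actT k V h X ∈ qext b q

variable (b q κ) in
/-- The invariance of `κ` under `G` on quantum antisymmetric tensors. -/
def KappaInvariant : Prop := ∀ (g h : G) (X : V ⊗[k] V), X ∈ qext b q →
  kap κ (h * g * h⁻¹) (actT k V h X) = actLow k V h (kap κ g X)

/-- Conjugation by `t_h` acts on the coefficients and permutes the `t_g` by
`g ↦ h g h⁻¹`. -/
theorem grp_mul_sum (h : G) (f : G → k × V) :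
    grp k V h * ∑ g : G, low G (f g) * grp k V g =
      (∑ g : G, low G (actLow k V h (f (h⁻¹ * g * h))) * grp k V g) * grp k V h := by
  rw [Finset.mul_sum, Finset.sum_mul]
  refine Fintype.sum_equiv (MulAut.conj h).toEquiv _ _ fun g => ?_
  rw [← mul_assoc, grp_mul_low, mul_assoc, mul_assoc, grp_mul, grp_mul]
  simp [mul_assoc]

/-- Conjugation by `t_h` carries relations to relations; this is where the invariance of `κ`
is used. -/
theorem grp_mul_rel (hext : PreservesQExt G b q) (hinv : KappaInvariant b q κ) (h : G)
    {X : V ⊗[k] V} (hX : X ∈ qext b q) :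
    grp k V h * rel b q κ X = rel b q κ (actT k V h X) * grp k V h := by
  rw [rel_of_mem_qext hX, rel_of_mem_qext (hext h X hX), mul_sub, sub_mul, mul_smul_comm,
    grp_mul_mulT, smul_mul_assoc, grp_mul_sum]
  have e : ∀ g : G, actLow k V h (kap κ (h⁻¹ * g * h) X) = kap κ g (actT k V h X) := fun g => by
    rw [← hinv _ h X hX]
    simp [mul_assoc]
  simp only [e]

variable (b q κ) in
/-- The span of the products `u r w t_g` of degree at most `d`, where `r` is a defining relation
of `H_{q,κ}`. -/
def relLE (d : ℕ) : Submodule k (SkewTensor k V G) :=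
  Submodule.span k {a | ∃ (u w : List (Fin n)) (i j : Fin n) (g : G), u.length + w.length + 2 ≤ d ∧
    a = mon G b u * rel b q κ (b i ⊗ₜ b j) * mon G b w * grp k V g}

theorem relLE_mono : Monotone (relLE b q κ) := fun _ _ h =>
  Submodule.span_mono fun _ ⟨u, w, i, j, g, hw, e⟩ => ⟨u, w, i, j, g, hw.trans h, e⟩

theorem vec_mul_mem_relLE {d : ℕ} {a : SkewTensor k V G} (ha : a ∈ relLE b q κ d) (x : V) :
    vec G x * a ∈ relLE b q κ (d + 1) := by
  refine map_mem_of_span (LinearMap.mulLeft k (vec G x)) ?_ ha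
  rintro _ ⟨u, w, i, j, g, hw, rfl⟩
  rw [LinearMap.mulLeft_apply, vec_eq_sum b, Finset.sum_mul]
  refine Submodule.sum_mem _ fun m _ => ?_
  rw [smul_mul_assoc]
  refine Submodule.smul_mem _ _ (Submodule.subset_span ⟨m :: u, w, i, j, g, ?_, ?_⟩)
  · simp only [List.length_cons]; omega
  · simp [mul_assoc]

theorem mul_vec_mem_relLE {d : ℕ} {a : SkewTensor k V G} (ha : a ∈ relLE b q κ d) (x : V) :
    a * vec G x ∈ relLE b q κ (d + 1) := by
  refine map_mem_of_span (LinearMap.mulRight k (vec G x)) ?_ ha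
  rintro _ ⟨u, w, i, j, g, hw, rfl⟩
  rw [LinearMap.mulRight_apply, mul_assoc, grp_mul_vec, vec_eq_sum b, Finset.sum_mul,
    Finset.mul_sum]
  refine Submodule.sum_mem _ fun m _ => ?_
  rw [smul_mul_assoc, mul_smul_comm, ← mul_assoc]
  refine Submodule.smul_mem _ _ (Submodule.subset_span ⟨u, w ++ [m], i, j, g, ?_, ?_⟩)
  · simp only [List.length_append, List.length_singleton]; omega
  · simp [mul_assoc]

theorem mul_grp_mem_relLE {d : ℕ} {a : SkewTensor k V G} (ha : a ∈ relLE b q κ d) (h : G) :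
    a * grp k V h ∈ relLE b q κ d := by
  refine map_mem_of_span (LinearMap.mulRight k (grp k V h)) ?_ ha
  rintro _ ⟨u, w, i, j, g, hw, rfl⟩
  rw [LinearMap.mulRight_apply, mul_assoc, grp_mul]
  exact Submodule.subset_span ⟨u, w, i, j, _, hw, rfl⟩

theorem mul_mon_mem_relLE {d : ℕ} {a : SkewTensor k V G} (ha : a ∈ relLE b q κ d)
    (w : List (Fin n)) : a * mon G b w ∈ relLE b q κ (d + w.length) := by
  induction w generalizing a d with
  | nil => simpa using ha
  | cons i w ih =>
    rw [mon_cons, ← mul_assoc]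
    have := ih (mul_vec_mem_relLE ha (b i))
    rwa [List.length_cons, ← add_assoc, add_right_comm]

theorem mon_mul_mem_relLE {d : ℕ} {a : SkewTensor k V G} (ha : a ∈ relLE b q κ d)
    (u : List (Fin n)) : mon G b u * a ∈ relLE b q κ (u.length + d) := by
  induction u with
  | nil => simpa using ha
  | cons i u ih =>
    rw [mon_cons, mul_assoc, List.length_cons, add_right_comm]
    exact vec_mul_mem_relLE ih (b i)

theorem mul_low_mem_relLE {d : ℕ} {a : SkewTensor k V G} (ha : a ∈ relLE b q κ d) (y : k × V) :
    a * low G y ∈ relLE b q κ (d + 1) := by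
  rw [low_apply, mul_add, ← Algebra.commutes, ← Algebra.smul_def]
  exact add_mem (Submodule.smul_mem _ _ (relLE_mono (Nat.le_succ d) ha)) (mul_vec_mem_relLE ha _)

theorem low_mul_mem_relLE {d : ℕ} {a : SkewTensor k V G} (ha : a ∈ relLE b q κ d) (y : k × V) :
    low G y * a ∈ relLE b q κ (d + 1) := by
  rw [low_apply, add_mul, ← Algebra.smul_def]
  exact add_mem (Submodule.smul_mem _ _ (relLE_mono (Nat.le_succ d) ha)) (vec_mul_mem_relLE ha _)

theorem rel_mem_relLE (X : V ⊗[k] V) : rel b q κ X ∈ relLE b q κ 2 := by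
  rw [← (b.tensorProduct b).sum_repr X, map_sum]
  refine Submodule.sum_mem _ fun p _ => ?_
  rw [map_smul, Module.Basis.tensorProduct_apply]
  exact Submodule.smul_mem _ _ (Submodule.subset_span ⟨[], [], p.1, p.2, 1, by simp,
    by simp [grp_one]⟩)

/-- The span of the relations of bounded degree absorbs group elements on the left. A general
relation is first replaced by its quantum antisymmetrization, on which `G` acts. -/
theorem grp_mul_mem_relLE (h2 : (2 : k) ≠ 0) (hq : ∀ i j, q i j * q j i = 1)
    (hκ : ∀ i j, κ (b i) (b j) = -(q i j • κ (b j) (b i)))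
    (hext : PreservesQExt G b q) (hinv : KappaInvariant b q κ)
    {d : ℕ} {a : SkewTensor k V G} (ha : a ∈ relLE b q κ d) (h : G) :
    grp k V h * a ∈ relLE b q κ d := by
  refine map_mem_of_span (LinearMap.mulLeft k (grp k V h)) ?_ ha
  rintro _ ⟨u, w, i, j, g, hw, rfl⟩
  rw [LinearMap.mulLeft_apply]
  refine relLE_mono hw ?_
  clear hw
  induction u with
  | nil =>
    rw [mon_nil, one_mul, ← mul_assoc, ← mul_assoc, rel_eq_half h2 hq hκ, mul_smul_comm,
      grp_mul_rel hext hinv h (sub_qswap_mem_qext hq _), ← smul_mul_assoc]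
    have := mul_mon_mem_relLE (mul_grp_mem_relLE (Submodule.smul_mem _ (2 : k)⁻¹ (rel_mem_relLE
      (b := b) (q := q) (κ := κ) (actT k V h (b i ⊗ₜ b j - qswap b q (b i ⊗ₜ b j))))) h) w
    refine mul_grp_mem_relLE ?_ g
    convert this using 2
    simp [add_comm]
  | cons m u ih =>
    have e : grp k V h * (mon G b (m :: u) * rel b q κ (b i ⊗ₜ b j) * mon G b w * grp k V g) =
        vec G (h • b m) * (grp k V h *
          (mon G b u * rel b q κ (b i ⊗ₜ b j) * mon G b w * grp k V g)) := by
      rw [← mul_assoc (vec G (h • b m)), ← grp_mul_vec]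
      simp [mul_assoc]
    rw [e]
    convert vec_mul_mem_relLE ih (h • b m) using 2
    simp only [List.length_cons]; omega

end Rel

/-! ### Overlaps of two relations -/

section Overlap

variable {k : Type u} {V : Type v} {G : Type w} [Field k] [AddCommGroup V] [Module k V]
  [Group G] [DistribMulAction G V] [SMulCommClass G k V] {n : ℕ}
  (b : Module.Basis (Fin n) k V) (q : Fin n → Fin n → k)
  (κ : V →ₗ[k] V →ₗ[k] (k × V) ⊗[k] MonoidAlgebra k G)

/-- The quadratic part of the coefficient of `t_g` in the difference of the two reductions of
`v_m v_j v_i`. -/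
def overlapQuad (i j m : Fin n) (g : G) : V ⊗[k] V :=
  (q j i * q m i) • b i ⊗ₜ[k] kappaL κ g (b m) (b j)
    - kappaL κ g (b m) (b j) ⊗ₜ[k] (g • b i)
    - q m j • b j ⊗ₜ[k] kappaL κ g (b m) (b i)
    + q j i • kappaL κ g (b m) (b i) ⊗ₜ[k] (g • b j)
    + b m ⊗ₜ[k] kappaL κ g (b j) (b i)
    - (q m i * q m j) • kappaL κ g (b j) (b i) ⊗ₜ[k] (g • b m)

/-- The linear part of the coefficient of `t_g` in the difference of the two reductions of
`v_m v_j v_i`, as an element of `k ⊕ V`. -/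
def overlapLin (i j m : Fin n) (g : G) : k × V :=
  (0, kappaC κ g (b m) (b j) • ((q j i * q m i) • b i - g • b i)
    - kappaC κ g (b m) (b i) • (q m j • b j - q j i • (g • b j))
    + kappaC κ g (b j) (b i) • (b m - (q m i * q m j) • (g • b m)))

variable (G) in
theorem low_mul_vec (y : k × V) (x : V) :
    low G y * vec G x = y.1 • vec G x + mulT k V G (y.2 ⊗ₜ x) := by
  rw [low_apply, add_mul, ← Algebra.smul_def, mulT_tmul]

variable (G) in
theorem vec_mul_low (y : k × V) (x : V) :
    vec G x * low G y = y.1 • vec G x + mulT k V G (x ⊗ₜ y.2) := by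
  rw [low_apply, mul_add, ← Algebra.commutes, ← Algebra.smul_def, mulT_tmul]

variable [Fintype G]

theorem inclusion_mul_vec (x y z : V) : inclusion (κ x y) * vec G z =
    ∑ g : G, (kappaC κ g x y • vecL k V G (g • z) +
      mulT k V G (kappaL κ g x y ⊗ₜ (g • z))) * grp k V g := by
  rw [inclusion_eq, Finset.sum_mul]
  refine Finset.sum_congr rfl fun g _ => ?_
  rw [mul_assoc, grp_mul_vec, ← mul_assoc, low_mul_vec]
  rfl

theorem vec_mul_inclusion (x y z : V) : vec G z * inclusion (κ x y) =
    ∑ g : G, (kappaC κ g x y • vecL k V G z +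
      mulT k V G (z ⊗ₜ kappaL κ g x y)) * grp k V g := by
  rw [inclusion_eq, Finset.mul_sum]
  refine Finset.sum_congr rfl fun g _ => ?_
  rw [← mul_assoc, vec_mul_low]
  rfl

/-- The terms of degree at most two in the difference of the two reductions of `v_m v_j v_i`. -/
def overlap (i j m : Fin n) : SkewTensor k V G :=
  ∑ g : G, (mulT k V G (overlapQuad b q κ i j m g) + low G (overlapLin b q κ i j m g)) * grp k V g

/-- The definition of `overlap` before its expansion into components. -/
theorem overlap_eq (i j m : Fin n) : overlap b q κ i j m =
    (q j i * q m i) • (vec G (b i) * inclusion (κ (b m) (b j)))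
      - inclusion (κ (b m) (b j)) * vec G (b i)
      - q m j • (vec G (b j) * inclusion (κ (b m) (b i)))
      + q j i • (inclusion (κ (b m) (b i)) * vec G (b j))
      + vec G (b m) * inclusion (κ (b j) (b i))
      - (q m i * q m j) • (inclusion (κ (b j) (b i)) * vec G (b m)) := by
  simp only [inclusion_mul_vec, vec_mul_inclusion, Finset.smul_sum, ← Finset.sum_sub_distrib,
    ← Finset.sum_add_distrib]
  refine Finset.sum_congr rfl fun g _ => ?_
  simp only [← smul_mul_assoc, ← sub_mul, ← add_mul]
  congr 1
  simp only [overlapQuad, overlapLin, low_apply, map_zero, zero_add, ← vecL_apply, map_sub,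
    map_add, map_smul, smul_sub, smul_add, smul_smul, mul_assoc, mul_comm]
  abel

/-- A purely formal identity: the cubic terms of the two reductions cancel. -/
theorem overlap_identity {A : Type*} [Ring A] [Algebra k A] (x y z K₁ K₂ K₃ : A) (r s t : k) :
    (z * y - r • (y * z) - K₁) * x - z * (y * x - s • (x * y) - K₃) =
      s • ((z * x - t • (x * z) - K₂) * y) + (s * t) • (x * (z * y - r • (y * z) - K₁))
        - r • (y * (z * x - t • (x * z) - K₂)) - (r * t) • ((y * x - s • (x * y) - K₃) * z)
        + ((s * t) • (x * K₁) - K₁ * x - r • (y * K₂) + s • (K₂ * y) + z * K₃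
          - (t * r) • (K₃ * z)) := by
  simp only [mul_sub, sub_mul, smul_mul_assoc, mul_smul_comm, mul_assoc, smul_sub,
    smul_smul, mul_left_comm, mul_comm t]
  abel

/-- The difference of the two reductions of `v_m v_j v_i` is `overlap`, up to relations at smaller
words. -/
theorem rel_mul_vec_sub (i j m : Fin n) :
    rel b q κ (b m ⊗ₜ b j) * vec G (b i) - vec G (b m) * rel b q κ (b j ⊗ₜ b i) =
      q j i • (rel b q κ (b m ⊗ₜ b i) * vec G (b j))
        + (q j i * q m i) • (vec G (b i) * rel b q κ (b m ⊗ₜ b j))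
        - q m j • (vec G (b j) * rel b q κ (b m ⊗ₜ b i))
        - (q m j * q m i) • (rel b q κ (b j ⊗ₜ b i) * vec G (b m))
        + overlap b q κ i j m := by
  rw [overlap_eq]
  simp only [rel_basis]
  exact overlap_identity _ _ _ _ _ _ _ _ _

/-- The constant and linear parts that remain in the coefficient of `t_g` when the quadratic part
of `overlap` is rewritten by the relations, up to a factor `2`. -/
def overlapRem (i j m : Fin n) (g : G) : k × V :=
  ∑ h : G, kap κ (g * h⁻¹) (overlapQuad b q κ i j m h) + (2 : k) • overlapLin b q κ i j m g

variable {b q κ} in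
/-- If the quadratic parts are quantum antisymmetric, they can be rewritten by the relations; what
remains has degree at most one. -/
theorem two_smul_overlap {i j m : Fin n} (h : ∀ g, overlapQuad b q κ i j m g ∈ qext b q) :
    (2 : k) • overlap b q κ i j m =
      ∑ g : G, rel b q κ (overlapQuad b q κ i j m g) * grp k V g
        + ∑ g : G, low G (overlapRem b q κ i j m g) * grp k V g := by
  have e : ∀ g : G, rel b q κ (overlapQuad b q κ i j m g) * grp k V g =
      (2 : k) • (mulT k V G (overlapQuad b q κ i j m g) * grp k V g)
        - ∑ h : G, low G (kap κ (h * g⁻¹) (overlapQuad b q κ i j m g)) * grp k V h := fun g => by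
    rw [rel_of_mem_qext (h g), sub_mul, smul_mul_assoc, Finset.sum_mul]
    congr 1
    refine Fintype.sum_equiv (Equiv.mulRight g) _ _ fun h' => ?_
    rw [mul_assoc, grp_mul]
    simp
  simp only [e, overlapRem, map_add, map_sum, map_smul, add_mul, Finset.sum_mul,
    Finset.sum_add_distrib, Finset.sum_sub_distrib, smul_mul_assoc]
  rw [Finset.sum_comm (f := fun h g => low G (kap κ (h * g⁻¹) (overlapQuad b q κ i j m g)) *
    grp k V h)]
  rw [overlap, Finset.smul_sum]
  simp only [add_mul, smul_add, Finset.sum_add_distrib]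
  abel

end Overlap

/-! ### Confluence -/

/-- A rewriting rule: it replaces a descent `v_i v_j`, `j < i`, inside the product of a word and a
group element. -/
structure Rule (n : ℕ) (G : Type*) where
  /-- The letters before the descent. -/
  left : List (Fin n)
  /-- The first, larger letter of the descent. -/
  fst : Fin n
  /-- The second, smaller letter of the descent. -/
  snd : Fin n
  /-- The letters decrease. -/
  lt : snd < fst
  /-- The letters after the descent. -/
  right : List (Fin n)
  /-- The group element. -/
  grp : G

namespace Rule

variable {n : ℕ} {G : Type w}

/-- The word that the rule rewrites. -/
def lhs (r : Rule n G) : GWord n G := ⟨r.left ++ r.fst :: r.snd :: r.right, r.grp⟩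

theorem not_mem_range_lhs {x : GWord n G} :
    x ∉ Set.range (lhs (n := n) (G := G)) ↔ x.word.Pairwise (· ≤ ·) := by
  constructor
  · intro h
    refine pairwise_of_no_descent fun u i j w hij e => h ⟨⟨u, j, i, hij, w, x.grp⟩, ?_⟩
    ext1
    · exact e.symm
    · rfl
  · rintro h ⟨r, rfl⟩
    have h1 := (List.pairwise_append.1 h).2.1
    exact absurd r.lt (not_lt.2 ((List.pairwise_cons.1 h1).1 _ (by simp)))

end Rule

section Confluence

variable {k : Type u} {V : Type v} {G : Type w} [Field k] [AddCommGroup V] [Module k V]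
  [Group G] [Fintype G] [DistribMulAction G V] [SMulCommClass G k V] {n : ℕ}
  (b : Module.Basis (Fin n) k V) (q : Fin n → Fin n → k)
  (κ : V →ₗ[k] V →ₗ[k] (k × V) ⊗[k] MonoidAlgebra k G)

/-- The element of the ideal of relations attached to a rule. -/
def Rule.elt (r : Rule n G) : SkewTensor k V G :=
  mon G b r.left * rel b q κ (b r.fst ⊗ₜ b r.snd) * mon G b r.right * QuantumDrinfeld.grp k V r.grp

variable {b q κ}

theorem degLE_le_span {d : ℕ} {x : GWord n G} (h : d < x.word.length) :
    degLE G b d ≤ Submodule.span k (wordBasis G b '' {y | y < x}) := by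
  refine Submodule.span_mono ?_
  rintro _ ⟨w, g, hw, rfl⟩
  exact ⟨⟨w, g⟩, GWord.lt_iff.2 (.inl (hw.trans_lt h)), wordBasis_apply b _⟩

/-- The result of a rule is a combination of smaller words: the swapped one, and shorter ones
from `κ`. -/
theorem Rule.sub_elt_mem (r : Rule n G) : wordBasis G b r.lhs - r.elt b q κ ∈
    Submodule.span k (wordBasis G b '' {y | y < r.lhs}) := by
  have e : wordBasis G b r.lhs - r.elt b q κ =
      q r.fst r.snd • wordBasis G b ⟨r.left ++ r.snd :: r.fst :: r.right, r.grp⟩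
        + mon G b r.left * inclusion (κ (b r.fst) (b r.snd)) * mon G b r.right *
          QuantumDrinfeld.grp k V r.grp := by
    rw [wordBasis_apply, wordBasis_apply, Rule.elt, rel_basis]
    simp only [lhs, mon_append, mon_cons, mul_sub, sub_mul, mul_smul_comm, smul_mul_assoc,
      mul_assoc]
    abel
  rw [e]
  refine add_mem (Submodule.smul_mem _ _ (Submodule.subset_span
    ⟨_, GWord.swap_lt r.lt _ _ _ _, rfl⟩)) (degLE_le_span (d := r.left.length + 1 +
      r.right.length) (by simp [lhs]; omega) ?_)
  rw [inclusion_eq, Finset.mul_sum, Finset.sum_mul, Finset.sum_mul]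
  refine Submodule.sum_mem _ fun g _ => mul_grp_mem_degLE (mul_mon_mem_degLE ?_ _) _
  rw [← mul_assoc]
  exact mul_grp_mem_degLE (mul_low_mem_degLE (mon_mem_degLE _) _) _

section
variable (h2 : (2 : k) ≠ 0) (hq : ∀ i j, q i j * q j i = 1)
  (hκ : ∀ i j, κ (b i) (b j) = -(q i j • κ (b j) (b i)))
include h2 hq hκ

theorem rel_diag (i : Fin n) (h1 : q i i = 1) : rel b q κ (b i ⊗ₜ b i) = 0 := by
  rw [rel_eq_half h2 hq hκ, qswap_basis, h1, one_smul, sub_self, map_zero, smul_zero]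

/-- A relation at an arbitrary pair of indices is, up to a scalar, a rule or zero. -/
theorem mon_rel_mem {s : Set (Rule n G)} (h1 : ∀ i, q i i = 1) (u w : List (Fin n)) (i j : Fin n)
    (g : G) (hs : ∀ (i' j' : Fin n) (h : j' < i'), (⟨u, i', j', h, w, g⟩ : Rule n G) ∈ s) :
    mon G b u * rel b q κ (b i ⊗ₜ b j) * mon G b w * grp k V g ∈
      Submodule.span k (Rule.elt b q κ '' s) := by
  rcases lt_trichotomy i j with h | rfl | h
  · have : rel b q κ (b i ⊗ₜ b j) = -(q i j • rel b q κ (b j ⊗ₜ b i)) := by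
      rw [← map_smul, ← qswap_basis, rel_qswap hq hκ, neg_neg]
    rw [this, ← neg_smul, mul_smul_comm, smul_mul_assoc, smul_mul_assoc]
    exact Submodule.smul_mem _ _ (Submodule.subset_span ⟨_, hs j i h, rfl⟩)
  · rw [rel_diag h2 hq hκ i (h1 i)]
    simp
  · exact Submodule.subset_span ⟨_, hs i j h, rfl⟩

theorem relLE_le_span (h1 : ∀ i, q i i = 1) {d : ℕ} {x : GWord n G} (h : d < x.word.length) :
    relLE b q κ d ≤ Submodule.span k (Rule.elt b q κ '' {t | t.lhs < x}) := by
  refine Submodule.span_le.2 ?_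
  rintro _ ⟨u, w, i, j, g, hw, rfl⟩
  refine mon_rel_mem h2 hq hκ h1 u w i j g fun i' j' h' => GWord.lt_iff.2 (.inl ?_)
  simp [Rule.lhs]
  omega

theorem relLE_le_span_range (h1 : ∀ i, q i i = 1) (d : ℕ) :
    relLE b q κ d ≤ Submodule.span k (Set.range (Rule.elt (G := G) b q κ)) := by
  rw [← Set.image_univ]
  refine Submodule.span_le.2 ?_
  rintro _ ⟨u, w, i, j, g, hw, rfl⟩
  exact mon_rel_mem h2 hq hκ h1 u w i j g fun i' j' h' => trivial

end

theorem Rule.elt_mem_relLE (r : Rule n G) :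
    r.elt b q κ ∈ relLE b q κ (r.left.length + r.right.length + 2) :=
  Submodule.subset_span ⟨_, _, _, _, _, le_rfl, rfl⟩

variable (b q κ) in
/-- The overlaps have no quadratic part in the quantum symmetric algebra. -/
def OverlapQuadZero : Prop := ∀ i j m : Fin n, i ≠ j → i ≠ m → j ≠ m → ∀ g : G,
  overlapQuad b q κ i j m g ∈ qext b q

variable (b q κ) in
/-- The linear and constant parts of the overlaps vanish. -/
def OverlapRemZero : Prop := ∀ i j m : Fin n, i ≠ j → i ≠ m → j ≠ m → ∀ g : G,
  overlapRem b q κ i j m g = 0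

theorem overlap_mem_relLE (h2 : (2 : k) ≠ 0) (hquad : OverlapQuadZero b q κ)
    (hrem : OverlapRemZero b q κ) {i j m : Fin n} (hij : i ≠ j) (him : i ≠ m) (hjm : j ≠ m) :
    overlap b q κ i j m ∈ relLE b q κ 2 := by
  have h := two_smul_overlap (fun g => hquad i j m hij him hjm g)
  simp only [hrem i j m hij him hjm, map_zero, zero_mul, Finset.sum_const_zero, add_zero] at h
  have : overlap b q κ i j m = (2 : k)⁻¹ • ((2 : k) • overlap b q κ i j m) := by
    rw [smul_smul, inv_mul_cancel₀ h2, one_smul]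
  rw [this, h]
  exact Submodule.smul_mem _ _ (Submodule.sum_mem _ fun g _ =>
    mul_grp_mem_relLE (rel_mem_relLE _) _)

section
variable (h2 : (2 : k) ≠ 0) (hq : ∀ i j, q i j * q j i = 1) (h1 : ∀ i, q i i = 1)
  (hκ : ∀ i j, κ (b i) (b j) = -(q i j • κ (b j) (b i)))
  (hext : PreservesQExt G b q) (hinv : KappaInvariant b q κ)
include h2 hq h1 hκ

/-- Confluence at an overlap `v_m v_j v_i`. The remaining relations sit at words obtained from
`m j i` by swaps, and `overlap` has lower degree. -/
theorem confluence_overlap (hquad : OverlapQuadZero b q κ) (hrem : OverlapRemZero b q κ)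
    (u w : List (Fin n)) {i j m : Fin n} (hij : i < j) (hjm : j < m) (g : G) :
    Rule.elt b q κ ⟨u, m, j, hjm, i :: w, g⟩ - Rule.elt b q κ ⟨u ++ [m], j, i, hij, w, g⟩ ∈
      Submodule.span k (Rule.elt b q κ '' {t | t.lhs < ⟨u ++ m :: j :: i :: w, g⟩}) := by
  have him := hij.trans hjm
  have l1 : (⟨u ++ m :: i :: j :: w, g⟩ : GWord n G) < ⟨u ++ m :: j :: i :: w, g⟩ := by
    have := GWord.swap_lt hij (u ++ [m]) w g g
    rwa [List.append_assoc, List.append_assoc] at this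
  have l2 : (⟨u ++ j :: m :: i :: w, g⟩ : GWord n G) < ⟨u ++ m :: j :: i :: w, g⟩ :=
    GWord.swap_lt hjm _ _ _ _
  have l3 : (⟨u ++ i :: m :: j :: w, g⟩ : GWord n G) < ⟨u ++ m :: j :: i :: w, g⟩ :=
    GWord.trans (GWord.swap_lt him u (j :: w) g g) l1
  have l4 : (⟨u ++ j :: i :: m :: w, g⟩ : GWord n G) < ⟨u ++ m :: j :: i :: w, g⟩ := by
    refine GWord.trans ?_ l2
    have := GWord.swap_lt him (u ++ [j]) w g g
    rwa [List.append_assoc, List.append_assoc] at this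
  have e : Rule.elt b q κ ⟨u, m, j, hjm, i :: w, g⟩ - Rule.elt b q κ ⟨u ++ [m], j, i, hij, w, g⟩ =
      q j i • Rule.elt b q κ ⟨u, m, i, him, j :: w, g⟩
        + (q j i * q m i) • Rule.elt b q κ ⟨u ++ [i], m, j, hjm, w, g⟩
        - q m j • Rule.elt b q κ ⟨u ++ [j], m, i, him, w, g⟩
        - (q m j * q m i) • Rule.elt b q κ ⟨u, j, i, hij, m :: w, g⟩
        + mon G b u * overlap b q κ i j m * mon G b w * grp k V g := by
    have := congrArg (fun a => mon G b u * a * mon G b w * grp k V g) (rel_mul_vec_sub b q κ i j m)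
    simp only [mul_add, mul_sub, add_mul, sub_mul, mul_smul_comm, smul_mul_assoc, mul_assoc] at this
    simp only [Rule.elt, mon_append, mon_cons, mon_nil, mul_one, mul_assoc]
    exact this
  rw [e]
  refine add_mem (sub_mem (sub_mem (add_mem ?_ ?_) ?_) ?_) ?_
  · exact Submodule.smul_mem _ _ (Submodule.subset_span ⟨_, l1, rfl⟩)
  · exact Submodule.smul_mem _ _ (Submodule.subset_span
      ⟨_, by simpa [Rule.lhs, List.append_assoc] using l3, rfl⟩)
  · exact Submodule.smul_mem _ _ (Submodule.subset_span
      ⟨_, by simpa [Rule.lhs, List.append_assoc] using l2, rfl⟩)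
  · exact Submodule.smul_mem _ _ (Submodule.subset_span ⟨_, l4, rfl⟩)
  · refine relLE_le_span h2 hq hκ h1 (d := u.length + 2 + w.length) (by simp; omega) ?_
    exact mul_grp_mem_relLE (mul_mon_mem_relLE (mon_mul_mem_relLE
      (overlap_mem_relLE h2 hquad hrem hij.ne him.ne hjm.ne) _) _) _

include hext hinv in
/-- Confluence at two disjoint descents. In the terms that come from `κ` of the left descent, a
group element has to be moved across the right relation. -/
theorem confluence_disjoint (u v w : List (Fin n)) {i j i' j' : Fin n} (h : j < i) (h' : j' < i')
    (g : G) :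
    Rule.elt b q κ ⟨u, i, j, h, v ++ i' :: j' :: w, g⟩
        - Rule.elt b q κ ⟨u ++ i :: j :: v, i', j', h', w, g⟩ ∈
      Submodule.span k (Rule.elt b q κ ''
        {t | t.lhs < ⟨u ++ i :: j :: (v ++ i' :: j' :: w), g⟩}) := by
  have l1 : (⟨u ++ i :: j :: (v ++ j' :: i' :: w), g⟩ : GWord n G) <
      ⟨u ++ i :: j :: (v ++ i' :: j' :: w), g⟩ := by
    have := GWord.swap_lt h' (u ++ i :: j :: v) w g g
    rwa [List.append_assoc, List.append_assoc] at this
  have l2 : (⟨u ++ j :: i :: (v ++ i' :: j' :: w), g⟩ : GWord n G) <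
      ⟨u ++ i :: j :: (v ++ i' :: j' :: w), g⟩ := GWord.swap_lt h _ _ _ _
  have e : Rule.elt b q κ ⟨u, i, j, h, v ++ i' :: j' :: w, g⟩
        - Rule.elt b q κ ⟨u ++ i :: j :: v, i', j', h', w, g⟩ =
      q i' j' • Rule.elt b q κ ⟨u, i, j, h, v ++ j' :: i' :: w, g⟩
        - q i j • Rule.elt b q κ ⟨u ++ j :: i :: v, i', j', h', w, g⟩
        + (Rule.elt b q κ ⟨u, i, j, h, v, 1⟩ * inclusion (κ (b i') (b j')) * mon G b w * grp k V g
          - mon G b u * (inclusion (κ (b i) (b j)) *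
            (mon G b v * rel b q κ (b i' ⊗ₜ b j') * mon G b w * grp k V g))) := by
    have e1 : ∀ i j, vec G (b i) * vec G (b j) = rel b q κ (b i ⊗ₜ b j) +
        q i j • (vec G (b j) * vec G (b i)) + inclusion (κ (b i) (b j)) := fun i j => by
      rw [rel_basis]; abel
    have e2 : ∀ (i j) (a : SkewTensor k V G), vec G (b i) * (vec G (b j) * a) =
        rel b q κ (b i ⊗ₜ b j) * a + q i j • (vec G (b j) * (vec G (b i) * a)) +
          inclusion (κ (b i) (b j)) * a := fun i j a => by
      rw [← mul_assoc, e1, add_mul, add_mul, smul_mul_assoc, mul_assoc]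
    simp only [Rule.elt, mon_append, mon_cons, mul_assoc, grp_one, one_mul]
    rw [e2 i' j', e2 i j]
    simp only [mul_add, mul_smul_comm]
    abel
  rw [e]
  refine add_mem (sub_mem ?_ ?_) ?_
  · exact Submodule.smul_mem _ _ (Submodule.subset_span ⟨_, l1, rfl⟩)
  · exact Submodule.smul_mem _ _ (Submodule.subset_span
      ⟨_, by simpa [Rule.lhs, List.append_assoc] using l2, rfl⟩)
  · refine relLE_le_span h2 hq hκ h1 (d := u.length + (v.length + w.length + 2 + 1))
      (by simp; omega) (sub_mem ?_ ?_)
    · rw [inclusion_eq, Finset.mul_sum, Finset.sum_mul, Finset.sum_mul]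
      refine Submodule.sum_mem _ fun g' _ => mul_grp_mem_relLE ?_ _
      rw [← mul_assoc]
      refine relLE_mono ?_ (mul_mon_mem_relLE (mul_grp_mem_relLE (mul_low_mem_relLE
        (Rule.elt_mem_relLE _) _) _) _)
      simp only
      omega
    · refine mon_mul_mem_relLE ?_ _
      rw [inclusion_eq, Finset.sum_mul]
      refine Submodule.sum_mem _ fun g' _ => ?_
      rw [mul_assoc]
      exact low_mul_mem_relLE (grp_mul_mem_relLE h2 hq hκ hext hinv
        (Submodule.subset_span ⟨_, _, _, _, _, le_rfl, rfl⟩) _) _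

include hext hinv in
theorem confluence (hquad : OverlapQuadZero b q κ) (hrem : OverlapRemZero b q κ)
    (r s : Rule n G) (hrs : r.lhs = s.lhs) :
    r.elt b q κ - s.elt b q κ ∈ Submodule.span k (Rule.elt b q κ '' {t | t.lhs < r.lhs}) := by
  wlog hle : r.left.length ≤ s.left.length generalizing r s
  · rw [← neg_sub, hrs]
    exact neg_mem (this s r hrs.symm (le_of_not_ge hle))
  obtain ⟨u, i, j, h, w, g⟩ := r
  obtain ⟨u', i', j', h', w', g'⟩ := s
  simp only [Rule.lhs, GWord.mk.injEq] at hrs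
  obtain ⟨hw, rfl⟩ := hrs
  -- The word `c` between the starts of the two descents is empty for equal rules, has one letter
  -- for an overlap, and begins with the first descent if they are disjoint.
  obtain ⟨c, rfl⟩ : ∃ c, u' = u ++ c := by
    rcases List.append_eq_append_iff.1 hw with ⟨c, e, -⟩ | ⟨c, e, -⟩
    · exact ⟨c, e⟩
    · refine ⟨[], ?_⟩
      subst e
      simp at hle
      simp [hle]
  rw [List.append_assoc, List.append_cancel_left_eq] at hw
  match c, hw with
  | [], hw =>
    simp only [List.nil_append, List.cons.injEq] at hw
    obtain ⟨rfl, rfl, rfl⟩ := hw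
    simp
  | [m], hw =>
    simp only [List.cons_append, List.nil_append, List.cons.injEq] at hw
    obtain ⟨rfl, rfl, rfl⟩ := hw
    exact confluence_overlap h2 hq h1 hκ hquad hrem u w' h' h g
  | m :: m' :: c, hw =>
    simp only [List.cons_append, List.cons.injEq] at hw
    obtain ⟨rfl, rfl, rfl⟩ := hw
    exact confluence_disjoint h2 hq h1 hκ hext hinv u c w' h h' g

include hext hinv in
/-- A normal form map: it kills the relations and fixes the weakly increasing words. -/
theorem exists_normalForm (hquad : OverlapQuadZero b q κ) (hrem : OverlapRemZero b q κ) :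
    ∃ L : SkewTensor k V G →ₗ[k] SkewTensor k V G, (∀ d, ∀ a ∈ relLE b q κ d, L a = 0) ∧
      ∀ w : List (Fin n), w.Pairwise (· ≤ ·) → ∀ g : G,
        L (mon G b w * grp k V g) = mon G b w * grp k V g := by
  obtain ⟨L, hL, hL'⟩ := exists_reduction (wordBasis G b) Rule.lhs (Rule.elt b q κ)
    Rule.sub_elt_mem (fun r s => confluence h2 hq h1 hκ hext hinv hquad hrem r s)
  refine ⟨L, fun d a ha => ?_, fun w hw g => ?_⟩
  · refine (Submodule.span_le (p := LinearMap.ker L)).2 ?_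
      (relLE_le_span_range h2 hq hκ h1 d ha)
    rintro _ ⟨r, rfl⟩
    exact hL r
  · have := hL' ⟨w, g⟩ (Rule.not_mem_range_lhs.2 hw)
    rwa [wordBasis_apply] at this

end

end Confluence

/-! ### The PBW property from confluence -/

section PBW

variable {k : Type u} {V : Type v} {G : Type w} [Field k] [AddCommGroup V] [Module k V]
  [Group G] [Fintype G] [DistribMulAction G V] [SMulCommClass G k V] {n : ℕ}
  (b : Module.Basis (Fin n) k V) (q : Fin n → Fin n → k)
  (κ : V →ₗ[k] V →ₗ[k] (k × V) ⊗[k] MonoidAlgebra k G)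

/-- The quotient map `T(V) # G → H_{q,κ}`. -/
abbrev toH : SkewTensor k V G →ₐ[k] HAlg b q κ := RingQuot.mkAlgHom k (HRel b q κ)

theorem toH_sub (x y : SkewTensor k V G) : toH b q κ (x - y) = toH b q κ x - toH b q κ y :=
  map_sub (toH b q κ) x y

theorem toH_rel (X : V ⊗[k] V) : toH b q κ (rel b q κ X) = 0 := by
  have : (toH b q κ).toLinearMap.comp (rel b q κ) = 0 := tensor_hom_ext b fun i j => by
    rw [LinearMap.comp_apply, rel_basis]
    exact (RingQuot.mkAlgHom_rel k (HRel.rel i j)).trans (map_zero _)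
  exact LinearMap.congr_fun this X

theorem toH_relLE {d : ℕ} {a : SkewTensor k V G} (ha : a ∈ relLE b q κ d) :
    toH b q κ a = 0 := by
  refine (Submodule.span_le (p := LinearMap.ker (toH b q κ).toLinearMap)).2 ?_ ha
  rintro _ ⟨u, w, i, j, g, -, rfl⟩
  change toH b q κ _ = 0
  simp only [map_mul, toH_rel, mul_zero, zero_mul]

theorem mon_sortedWord (m : Fin n → ℕ) :
    mon G b (sortedWord m) = (List.ofFn fun i => vec G (b i) ^ m i).prod := by
  simp [mon, sortedWord, List.map_flatten, List.prod_flatten, List.map_ofFn, Function.comp_def]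

theorem monomial_eq (p : (Fin n → ℕ) × G) :
    HAlg.monomial b q κ p = toH b q κ (mon G b (sortedWord p.1) * grp k V p.2) := by
  rw [mon_sortedWord]; rfl

/-- The two-sided ideal of relations. -/
def relIdeal : Submodule k (SkewTensor k V G) := ⨆ d, relLE b q κ d

variable {b q κ}

theorem mem_relIdeal {a : SkewTensor k V G} : a ∈ relIdeal b q κ ↔ ∃ d, a ∈ relLE b q κ d :=
  Submodule.mem_iSup_of_directed _ relLE_mono.directed_le

theorem mul_mem_relIdeal {a : SkewTensor k V G} (ha : a ∈ relIdeal b q κ)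
    (x : SkewTensor k V G) : a * x ∈ relIdeal b q κ := by
  obtain ⟨d, hd⟩ := mem_relIdeal.1 ha
  rw [← (wordBasis G b).linearCombination_repr x, Finsupp.linearCombination_apply, Finsupp.sum,
    Finset.mul_sum]
  refine Submodule.sum_mem _ fun y _ => ?_
  rw [mul_smul_comm, wordBasis_apply, ← mul_assoc]
  exact Submodule.smul_mem _ _
    (mem_relIdeal.2 ⟨_, mul_grp_mem_relLE (mul_mon_mem_relLE hd _) _⟩)

section
variable (h2 : (2 : k) ≠ 0) (hq : ∀ i j, q i j * q j i = 1) (h1 : ∀ i, q i i = 1)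
  (hκ : ∀ i j, κ (b i) (b j) = -(q i j • κ (b j) (b i)))
  (hext : PreservesQExt G b q) (hinv : KappaInvariant b q κ)
include h2 hq hκ hext hinv

theorem mul_mem_relIdeal_left {a : SkewTensor k V G} (ha : a ∈ relIdeal b q κ)
    (x : SkewTensor k V G) : x * a ∈ relIdeal b q κ := by
  obtain ⟨d, hd⟩ := mem_relIdeal.1 ha
  rw [← (wordBasis G b).linearCombination_repr x, Finsupp.linearCombination_apply, Finsupp.sum,
    Finset.sum_mul]
  refine Submodule.sum_mem _ fun y _ => ?_
  rw [smul_mul_assoc, wordBasis_apply, mul_assoc]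
  exact Submodule.smul_mem _ _ (mem_relIdeal.2 ⟨_, mon_mul_mem_relLE
    (grp_mul_mem_relLE h2 hq hκ hext hinv hd _) _⟩)

/-- The kernel of `T(V) # G → H_{q,κ}` is the union of the filtered pieces `relLE`; the point is that
this union absorbs left multiplication by group elements. -/
theorem mem_relIdeal_of_toH_eq_zero {a : SkewTensor k V G} (ha : toH b q κ a = 0) :
    a ∈ relIdeal b q κ := by
  let I : TwoSidedIdeal (SkewTensor k V G) := TwoSidedIdeal.mk' (relIdeal b q κ)
    (zero_mem _) (fun h h' => add_mem h h') (fun h => neg_mem h)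
    (fun h => mul_mem_relIdeal_left h2 hq hκ hext hinv h _) (fun h => mul_mem_relIdeal h _)
  have hI : ∀ x, x ∈ I ↔ x ∈ relIdeal b q κ := fun x =>
    TwoSidedIdeal.mem_mk' _ _ _ _ _ _ _
  let f : SkewTensor k V G →+* I.ringCon.Quotient := I.ringCon.mk'
  have hf : ∀ x, f x = 0 ↔ x ∈ I := fun x => by
    rw [TwoSidedIdeal.mem_iff]
    exact I.ringCon.eq
  have hr : ∀ ⦃x y⦄, HRel b q κ x y → f x = f y := by
    rintro _ _ ⟨i, j⟩
    rw [map_zero, hf, hI, ← rel_basis]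
    exact mem_relIdeal.2 ⟨2, rel_mem_relLE _⟩
  rw [← hI, ← hf, ← RingQuot.lift_mkRingHom_apply f hr, ← RingQuot.mkAlgHom_coe k]
  change RingQuot.lift ⟨f, hr⟩ (toH b q κ a) = 0
  rw [ha, map_zero]

include h1 in
/-- The conditions are sufficient for the PBW property. -/
theorem isQuantumDrinfeldOrbifold_of_confluent (hquad : OverlapQuadZero b q κ)
    (hrem : OverlapRemZero b q κ) : IsQuantumDrinfeldOrbifold b q κ := by
  obtain ⟨L, hL, hL'⟩ := exists_normalForm h2 hq h1 hκ hext hinv hquad hrem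
  constructor
  · have hli : LinearIndependent k fun p : (Fin n → ℕ) × G =>
        wordBasis G b ⟨sortedWord p.1, p.2⟩ :=
      (wordBasis G b).linearIndependent.comp _ fun p p' h => by
        simp only [GWord.mk.injEq] at h
        exact Prod.ext (sortedWord_injective h.1) h.2
    have hmon : ∀ c : (Fin n → ℕ) × G →₀ k, Finsupp.linearCombination k (HAlg.monomial b q κ) c =
        toH b q κ (Finsupp.linearCombination k (fun p : (Fin n → ℕ) × G =>
          wordBasis G b ⟨sortedWord p.1, p.2⟩) c) := fun c => by
      simp only [Finsupp.linearCombination_apply, Finsupp.sum, map_sum, map_smul, monomial_eq,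
        wordBasis_apply]
    intro c c' hc
    rw [hmon, hmon, ← sub_eq_zero, ← toH_sub, ← map_sub] at hc
    obtain ⟨d, hd⟩ := mem_relIdeal.1 (mem_relIdeal_of_toH_eq_zero h2 hq hκ hext hinv hc)
    have h0 := hL d _ hd
    rw [Finsupp.linearCombination_apply, Finsupp.sum, map_sum] at h0
    rw [← sub_eq_zero]
    apply linearIndependent_iff.1 hli
    rw [Finsupp.linearCombination_apply, Finsupp.sum, ← h0]
    refine Finset.sum_congr rfl fun p _ => ?_
    rw [map_smul, wordBasis_apply, hL' _ (sortedWord_pairwise _)]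
  · rw [eq_top_iff]
    rintro x -
    obtain ⟨a, rfl⟩ := RingQuot.mkAlgHom_surjective k (HRel b q κ) x
    have ha : a ∈ (⊤ : Submodule k (SkewTensor k V G)) := trivial
    rw [← span_irreducible (wordBasis G b) Rule.lhs (Rule.elt b q κ) Rule.sub_elt_mem] at ha
    refine (sup_le (c := (Submodule.span k (Set.range (HAlg.monomial b q κ))).comap
      (toH b q κ).toLinearMap) ?_ ?_ : _) ha
    · refine Submodule.span_le.2 ?_
      rintro _ ⟨⟨w, g⟩, hx, rfl⟩
      have hw := Rule.not_mem_range_lhs.1 hx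
      refine Submodule.subset_span ⟨(fun i => w.count i, g), ?_⟩
      rw [monomial_eq, sortedWord_count hw, wordBasis_apply]
      rfl
    · refine Submodule.span_le.2 ?_
      rintro _ ⟨r, rfl⟩
      rw [SetLike.mem_coe, Submodule.mem_comap, AlgHom.toLinearMap_apply,
        toH_relLE b q κ r.elt_mem_relLE]
      exact zero_mem _

end
end PBW

/-! ### Consequences of the PBW property in low degree -/

section Necessity

variable {k : Type u} {V : Type v} {G : Type w} [Field k] [AddCommGroup V] [Module k V]
  [Group G] [Fintype G] [DistribMulAction G V] [SMulCommClass G k V] {n : ℕ}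
  {b : Module.Basis (Fin n) k V} {q : Fin n → Fin n → k}
  {κ : V →ₗ[k] V →ₗ[k] (k × V) ⊗[k] MonoidAlgebra k G}

/-- The basis of monomials of an algebra with the PBW property. -/
def pbwBasis (hP : IsQuantumDrinfeldOrbifold b q κ) :
    Module.Basis ((Fin n → ℕ) × G) k (HAlg b q κ) :=
  Module.Basis.mk hP.1 hP.2.ge

theorem toH_sorted (hP : IsQuantumDrinfeldOrbifold b q κ) {w : List (Fin n)}
    (hw : w.Pairwise (· ≤ ·)) (g : G) :
    toH b q κ (mon G b w * grp k V g) = pbwBasis hP (fun i => w.count i, g) := by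
  rw [pbwBasis, Module.Basis.mk_apply, monomial_eq, sortedWord_count hw]

/-- The coefficient of a weakly increasing word and a group element in the PBW basis. -/
def pbwCoord (hP : IsQuantumDrinfeldOrbifold b q κ) (w : List (Fin n)) (g : G) :
    SkewTensor k V G →ₗ[k] k :=
  ((pbwBasis hP).coord (fun i => w.count i, g)).comp (toH b q κ).toLinearMap

open Classical in
theorem pbwCoord_sorted (hP : IsQuantumDrinfeldOrbifold b q κ) {w w' : List (Fin n)}
    (hw : w.Pairwise (· ≤ ·)) (hw' : w'.Pairwise (· ≤ ·)) (g g' : G) :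
    pbwCoord hP w g (mon G b w' * grp k V g') = if w' = w ∧ g' = g then 1 else 0 := by
  rw [pbwCoord, LinearMap.comp_apply, AlgHom.toLinearMap_apply, toH_sorted hP hw',
    Module.Basis.coord_apply, Module.Basis.repr_self, Finsupp.single_apply]
  refine if_congr ?_ rfl rfl
  rw [Prod.mk.injEq]
  refine and_congr_left fun _ => ⟨fun h => ?_, fun h => by rw [h]⟩
  rw [← sortedWord_count hw', h, sortedWord_count hw]

theorem pbwCoord_eq_zero (hP : IsQuantumDrinfeldOrbifold b q κ) (w : List (Fin n)) (g : G)
    {a : SkewTensor k V G} (h : toH b q κ a = 0) : pbwCoord hP w g a = 0 := by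
  rw [pbwCoord, LinearMap.comp_apply, AlgHom.toLinearMap_apply, h, map_zero]

theorem low_mul_grp_eq (b : Module.Basis (Fin n) k V) (y : k × V) (h : G) :
    low G y * grp k V h = y.1 • (mon G b [] * grp k V h) +
      ∑ i, b.repr y.2 i • (mon G b [i] * grp k V h) := by
  rw [low_apply, vec_eq_sum b, add_mul, ← Algebra.smul_def, Finset.sum_mul]
  simp

open Classical in
theorem pbwCoord_low_nil (hP : IsQuantumDrinfeldOrbifold b q κ) (y : k × V) (g h : G) :
    pbwCoord hP [] g (low G y * grp k V h) = if h = g then y.1 else 0 := by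
  rw [low_mul_grp_eq b, map_add, map_sum, map_smul, pbwCoord_sorted hP .nil .nil]
  simp only [map_smul, pbwCoord_sorted hP .nil (List.pairwise_singleton _ _)]
  simp

open Classical in
theorem pbwCoord_low_singleton (hP : IsQuantumDrinfeldOrbifold b q κ) (i : Fin n) (y : k × V)
    (g h : G) :
    pbwCoord hP [i] g (low G y * grp k V h) = if h = g then b.repr y.2 i else 0 := by
  rw [low_mul_grp_eq b, map_add, map_sum, map_smul,
    pbwCoord_sorted hP (List.pairwise_singleton _ _) .nil]
  simp only [map_smul, pbwCoord_sorted hP (List.pairwise_singleton _ _)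
    (List.pairwise_singleton _ _)]
  by_cases hg : h = g <;> simp [hg]

theorem pbwCoord_low_pair (hP : IsQuantumDrinfeldOrbifold b q κ) {i j : Fin n} (hij : i ≤ j)
    (y : k × V) (g h : G) :
    pbwCoord hP [i, j] g (low G y * grp k V h) = 0 := by
  rw [low_mul_grp_eq b, map_add, map_sum, map_smul,
    pbwCoord_sorted hP (List.pairwise_pair.2 hij) .nil]
  simp only [map_smul, pbwCoord_sorted hP (List.pairwise_pair.2 hij)
    (List.pairwise_singleton _ _)]
  simp

/-- Elements of degree at most one are linearly independent in `H_{q,κ}`. -/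
theorem eq_zero_of_toH_low (hP : IsQuantumDrinfeldOrbifold b q κ) {f : G → k × V}
    (h : toH b q κ (∑ g : G, low G (f g) * grp k V g) = 0) (g : G) : f g = 0 := by
  classical
  have h0 := pbwCoord_eq_zero hP [] g h
  simp only [map_sum, pbwCoord_low_nil] at h0
  have hi := fun i => pbwCoord_eq_zero hP [i] g h
  simp only [map_sum, pbwCoord_low_singleton] at hi
  refine Prod.ext (by simpa using h0) (b.ext_elem fun i => ?_)
  simpa using hi i

theorem repr_qswap (X : V ⊗[k] V) (i j : Fin n) :
    (b.tensorProduct b).repr (qswap b q X) (i, j) =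
      q j i * (b.tensorProduct b).repr X (j, i) := by
  have : ((b.tensorProduct b).coord (i, j)).comp (qswap b q) =
      q j i • (b.tensorProduct b).coord (j, i) := tensor_hom_ext b fun s t => by
    classical
    by_cases h : s = j ∧ t = i
    · obtain ⟨rfl, rfl⟩ := h
      simp
    · have h' : ¬ (t = i ∧ s = j) := fun e => h e.symm
      simp [Finsupp.single_apply]
      grind
  exact LinearMap.congr_fun this X

open Classical in
/-- The quadratic coordinates of a tensor in the PBW basis are those of its quantum
symmetrization, up to a factor `2` on the diagonal. -/
theorem pbwCoord_mulT (hq1 : ∀ i, q i i = 1) (hP : IsQuantumDrinfeldOrbifold b q κ) {i j : Fin n}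
    (hij : i ≤ j) (g h : G) (X : V ⊗[k] V) :
    (if i = j then (2 : k) else 1) * pbwCoord hP [i, j] g (mulT k V G X * grp k V h) =
      if h = g then (b.tensorProduct b).repr (X + qswap b q X) (i, j) else 0 := by
  -- Both sides are linear in `X`, so it suffices to compare them on the basis `v_s ⊗ v_t`, where
  -- the monomial `v_s v_t` is either sorted or becomes so by one relation.
  have hs : ∀ {s t : Fin n}, s ≤ t → pbwCoord hP [i, j] g (vec G (b s) * vec G (b t) * grp k V h) =
      if (s = i ∧ t = j) ∧ h = g then 1 else 0 := fun {s t} hst => by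
    have := pbwCoord_sorted hP (List.pairwise_pair.2 hij) (List.pairwise_pair.2 hst) g h
    simpa [mul_assoc] using this
  have hswap : ∀ s t : Fin n,
      pbwCoord hP [i, j] g (vec G (b s) * vec G (b t) * grp k V h) =
        q s t * pbwCoord hP [i, j] g (vec G (b t) * vec G (b s) * grp k V h) := fun s t => by
    have h0 : pbwCoord hP [i, j] g (rel b q κ (b s ⊗ₜ b t) * grp k V h) = 0 :=
      pbwCoord_eq_zero hP _ _ (by rw [map_mul, toH_rel, zero_mul])
    have h1 : pbwCoord hP [i, j] g (inclusion (κ (b s) (b t)) * grp k V h) = 0 := by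
      rw [inclusion_eq, Finset.sum_mul, map_sum]
      refine Finset.sum_eq_zero fun g' _ => ?_
      rw [mul_assoc, grp_mul, pbwCoord_low_pair hP hij]
    rw [rel_basis, sub_mul, sub_mul, smul_mul_assoc, map_sub, map_sub, h1, map_smul, smul_eq_mul,
      sub_zero, sub_eq_zero] at h0
    exact h0
  have key : (if i = j then (2 : k) else 1) •
        (pbwCoord hP [i, j] g).comp ((LinearMap.mulRight k (grp k V h)).comp (mulT k V G)) =
      (if h = g then (1 : k) else 0) •
        ((b.tensorProduct b).coord (i, j)).comp (LinearMap.id + qswap b q) :=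
    tensor_hom_ext b fun s t => by
      have e : (b.tensorProduct b).repr (b s ⊗ₜ[k] b t) (i, j) =
          if s = i ∧ t = j then 1 else 0 := by
        rw [← Module.Basis.tensorProduct_apply, Module.Basis.repr_self, Finsupp.single_apply]
        simp
      have e' : (b.tensorProduct b).repr (b t ⊗ₜ[k] b s) (i, j) =
          if t = i ∧ s = j then 1 else 0 := by
        rw [← Module.Basis.tensorProduct_apply, Module.Basis.repr_self, Finsupp.single_apply]
        simp
      simp only [LinearMap.smul_apply, LinearMap.comp_apply, LinearMap.mulRight_apply, mulT_tmul,
        LinearMap.add_apply, LinearMap.id_apply, qswap_basis, map_add, map_smul,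
        Module.Basis.coord_apply, e, e', smul_eq_mul]
      rcases lt_trichotomy s t with hst | rfl | hst
      · rw [hs hst.le]
        have : ¬ (t = i ∧ s = j) := by rintro ⟨rfl, rfl⟩; exact absurd hst (not_lt.2 hij)
        have : s = i ∧ t = j → i ≠ j := by rintro ⟨rfl, rfl⟩; exact hst.ne
        grind
      · rw [hs le_rfl, hq1]
        grind
      · rw [hswap, hs hst.le]
        have : ¬ (s = i ∧ t = j) := by rintro ⟨rfl, rfl⟩; exact absurd hst (not_lt.2 hij)
        have : t = i ∧ s = j → i ≠ j := by rintro ⟨rfl, rfl⟩; exact hst.ne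
        grind
  have := LinearMap.congr_fun key X
  simp only [LinearMap.smul_apply, LinearMap.comp_apply, LinearMap.mulRight_apply,
    LinearMap.add_apply, LinearMap.id_apply, Module.Basis.coord_apply, smul_eq_mul, ite_mul,
    one_mul, zero_mul] at this
  simpa only [ite_mul, one_mul] using this

/-- If an element of degree at most two vanishes in `H_{q,κ}`, its quadratic part vanishes in the
quantum symmetric algebra. -/
theorem mem_qext_of_toH (hq : ∀ i j, q i j * q j i = 1)
    (hq1 : ∀ i, q i i = 1) (hP : IsQuantumDrinfeldOrbifold b q κ) {X : G → V ⊗[k] V}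
    {Y : G → k × V}
    (h : toH b q κ (∑ g : G, (mulT k V G (X g) + low G (Y g)) * grp k V g) = 0) (g : G) :
    X g ∈ qext b q := by
  classical
  have hle : ∀ i j, i ≤ j → (b.tensorProduct b).repr (X g + qswap b q (X g)) (i, j) = 0 :=
    fun i j hij => by
      have h0 := pbwCoord_eq_zero hP [i, j] g h
      simp only [add_mul, map_sum, map_add, pbwCoord_low_pair hP hij, add_zero] at h0
      have h1 := congrArg ((if i = j then (2 : k) else 1) * ·) h0
      simp only [Finset.mul_sum, pbwCoord_mulT hq1 hP hij, mul_zero] at h1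
      simpa using h1
  have : X g + qswap b q (X g) = 0 := by
    refine (b.tensorProduct b).ext_elem fun p => ?_
    obtain ⟨i, j⟩ := p
    rw [map_zero, Finsupp.zero_apply]
    rcases le_total i j with hij | hij
    · exact hle i j hij
    · have e : qswap b q (X g + qswap b q (X g)) = X g + qswap b q (X g) := by
        rw [map_add, qswap_qswap b hq, add_comm]
      rw [← e, repr_qswap, hle j i hij, mul_zero]
  rw [mem_qext]
  exact eq_neg_of_add_eq_zero_right this

/-- Conjugating a relation by `t_h` gives a relation with the same quadratic part as that of the
transformed tensor; their difference has degree at most one. -/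
theorem kappaInvariant_of_pbw (hP : IsQuantumDrinfeldOrbifold b q κ)
    (hext : PreservesQExt G b q) : KappaInvariant b q κ := by
  intro g h X hX
  have e : (∑ g : G, low G (kap κ g (actT k V h X) - actLow k V h (kap κ (h⁻¹ * g * h) X)) *
      grp k V g) = grp k V h * rel b q κ X * grp k V h⁻¹ - rel b q κ (actT k V h X) := by
    rw [rel_of_mem_qext hX, rel_of_mem_qext (hext h X hX), mul_sub, mul_smul_comm, grp_mul_mulT,
      grp_mul_sum, ← smul_mul_assoc, ← sub_mul, mul_assoc, grp_mul, mul_inv_cancel, grp_one,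
      mul_one]
    simp only [map_sub, sub_mul, Finset.sum_sub_distrib]
    abel
  have h0 : toH b q κ (∑ g : G, low G (kap κ g (actT k V h X) -
      actLow k V h (kap κ (h⁻¹ * g * h) X)) * grp k V g) = 0 := by
    rw [e, toH_sub, map_mul, map_mul, toH_rel, toH_rel, mul_zero, zero_mul]
    exact sub_zero (0 : HAlg b q κ)
  have := eq_zero_of_toH_low hP h0 (h * g * h⁻¹)
  rw [sub_eq_zero] at this
  rw [this]
  simp [mul_assoc]

theorem toH_overlap (i j m : Fin n) : toH b q κ (overlap b q κ i j m) = 0 := by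
  have hl : ∀ X a, rel b q κ X * a ∈ LinearMap.ker (toH b q κ).toLinearMap := fun X a => by
    rw [LinearMap.mem_ker, AlgHom.toLinearMap_apply, map_mul, toH_rel, zero_mul]
  have hr : ∀ X a, a * rel b q κ X ∈ LinearMap.ker (toH b q κ).toLinearMap := fun X a => by
    rw [LinearMap.mem_ker, AlgHom.toLinearMap_apply, map_mul, toH_rel, mul_zero]
  suffices h : overlap b q κ i j m ∈ LinearMap.ker (toH b q κ).toLinearMap from h
  rw [eq_sub_of_add_eq' (rel_mul_vec_sub b q κ i j m).symm]
  exact sub_mem (sub_mem (hl _ _) (hr _ _)) (sub_mem (sub_mem (add_mem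
    (Submodule.smul_mem _ _ (hl _ _)) (Submodule.smul_mem _ _ (hr _ _)))
    (Submodule.smul_mem _ _ (hr _ _))) (Submodule.smul_mem _ _ (hl _ _)))

theorem overlapQuadZero_of_pbw (hq : ∀ i j, q i j * q j i = 1)
    (hq1 : ∀ i, q i i = 1) (hP : IsQuantumDrinfeldOrbifold b q κ) : OverlapQuadZero b q κ :=
  fun i j m _ _ _ g => mem_qext_of_toH hq hq1 hP (toH_overlap i j m) g

theorem overlapRemZero_of_pbw (hq : ∀ i j, q i j * q j i = 1)
    (hq1 : ∀ i, q i i = 1) (hP : IsQuantumDrinfeldOrbifold b q κ) : OverlapRemZero b q κ := by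
  intro i j m hij him hjm g
  have h := congrArg (toH b q κ)
    (two_smul_overlap fun g => overlapQuadZero_of_pbw hq hq1 hP i j m hij him hjm g)
  rw [map_smul, toH_overlap, smul_zero, map_add, map_sum] at h
  simp only [map_mul (toH b q κ) (rel b q κ _), toH_rel, zero_mul, Finset.sum_const_zero,
    zero_add] at h
  exact eq_zero_of_toH_low hP h.symm g

/-- The PBW theorem in terms of tensors, for an action that preserves the quadratic relations of
`S_q(V)`. -/
theorem isQuantumDrinfeldOrbifold_iff (h2 : (2 : k) ≠ 0) (hq : ∀ i j, q i j * q j i = 1)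
    (hq1 : ∀ i, q i i = 1) (hκ : ∀ i j, κ (b i) (b j) = -(q i j • κ (b j) (b i)))
    (hext : PreservesQExt G b q) :
    IsQuantumDrinfeldOrbifold b q κ ↔
      KappaInvariant b q κ ∧ OverlapQuadZero b q κ ∧ OverlapRemZero b q κ :=
  ⟨fun hP => ⟨kappaInvariant_of_pbw hP hext, overlapQuadZero_of_pbw hq hq1 hP,
    overlapRemZero_of_pbw hq hq1 hP⟩,
  fun ⟨hinv, hquad, hrem⟩ =>
    isQuantumDrinfeldOrbifold_of_confluent h2 hq hq1 hκ hext hinv hquad hrem⟩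

end Necessity

/-! ### Quadratic relations of the quantum symmetric algebra -/

section QSym

variable {k : Type u} {V : Type v} [Field k] [AddCommGroup V] [Module k V] {n : ℕ}
  {b : Module.Basis (Fin n) k V} {q : Fin n → Fin n → k}

variable (b q) in
/-- Multiplication `V ⊗ V → S_q(V)`. -/
def mulS : V ⊗[k] V →ₗ[k] QSym b q :=
  TensorProduct.lift ((LinearMap.mul k (QSym b q)).compl₁₂ (QSym.ι b q) (QSym.ι b q))

@[simp] theorem mulS_tmul (x y : V) :
    mulS b q (x ⊗ₜ y) = QSym.ι b q x * QSym.ι b q y := rfl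

theorem mulS_qswap (X : V ⊗[k] V) : mulS b q (qswap b q X) = mulS b q X := by
  have : (mulS b q).comp (qswap b q) = mulS b q := tensor_hom_ext b fun i j => by
    have h := RingQuot.mkAlgHom_rel k (SymRel.comm (b := b) (q := q) i j)
    rw [map_smul, map_mul, map_mul] at h
    rw [LinearMap.comp_apply, qswap_basis, map_smul]
    exact h.symm
  exact LinearMap.congr_fun this X

section Trivial

variable {G : Type w} [Group G] [Fintype G] [DistribMulAction G V] [SMulCommClass G k V]
  {κ : V →ₗ[k] V →ₗ[k] (k × V) ⊗[k] MonoidAlgebra k G}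

/-- The algebra `H_{q,0}` of the trivial group has the PBW property: its relations are
homogeneous and their overlaps resolve without remainder. -/
theorem isQuantumDrinfeldOrbifold_zero [Subsingleton G] (h2 : (2 : k) ≠ 0)
    (hq : ∀ i j, q i j * q j i = 1) (hq1 : ∀ i, q i i = 1) (hκ : κ = 0) :
    IsQuantumDrinfeldOrbifold b q κ := by
  subst hκ
  have hκ0 : ∀ g : G, kap (k := k) (V := V) 0 g = 0 := fun g =>
    TensorProduct.ext' fun x y => by simp [kap]
  have hL : ∀ (g : G) (x y : V), kappaL (k := k) 0 g x y = 0 := fun g x y => by simp [kappaL]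
  have hC : ∀ (g : G) (x y : V), kappaC (k := k) 0 g x y = 0 := fun g x y => by simp [kappaC]
  have hext : PreservesQExt G b q := fun g X hX => by
    have : actT k V g = LinearMap.id := TensorProduct.ext' fun x y => by
      rw [Subsingleton.elim g 1]; simp
    rwa [this]
  have hquad0 : ∀ i j m (g : G), overlapQuad b q 0 i j m g = 0 := fun i j m g => by
    simp [overlapQuad, hL]
  refine (isQuantumDrinfeldOrbifold_iff h2 hq hq1 (fun i j => by simp) hext).2
    ⟨fun g h X _ => ?_, fun i j m _ _ _ g => ?_, fun i j m _ _ _ g => ?_⟩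
  · rw [hκ0, hκ0, LinearMap.zero_apply, LinearMap.zero_apply, map_zero]
  · rw [hquad0]; exact zero_mem _
  · simp [overlapRem, hquad0, overlapLin, hC]

/-- The algebra `S_q(V)` maps to `H_{q,0}`, where quadratic elements are controlled by the PBW
property. -/
theorem mem_qext_of_mulS_eq_zero (hq : ∀ i j, q i j * q j i = 1)
    (hq1 : ∀ i, q i i = 1) (hκ : κ = 0) (hP : IsQuantumDrinfeldOrbifold b q κ) {X : V ⊗[k] V}
    (h : mulS b q X = 0) : X ∈ qext b q := by
  let f : TensorAlgebra k V →ₐ[k] HAlg b q κ :=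
    (toH b q κ).comp (TensorAlgebra.lift k (vecL k V G))
  have hfι : ∀ x, f (TensorAlgebra.ι k x) = toH b q κ (vec G x) := fun x => by simp [f]
  have hf : ∀ ⦃x y⦄, SymRel b q x y → f x = f y := by
    rintro _ _ ⟨i, j⟩
    have h0 := toH_rel b q κ (b i ⊗ₜ b j)
    rw [rel_basis, hκ, LinearMap.zero_apply, LinearMap.zero_apply, inclusion_eq] at h0
    simp only [map_zero, zero_mul, Finset.sum_const_zero, sub_zero] at h0
    rw [← hκ, toH_sub, map_smul, map_mul, map_mul] at h0
    rw [map_smul, map_mul, map_mul, hfι, hfι]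
    exact sub_eq_zero.1 h0
  let F : QSym b q →ₐ[k] HAlg b q κ := RingQuot.liftAlgHom k ⟨f, hf⟩
  have hF : F.toLinearMap.comp (mulS b q) = (toH b q κ).toLinearMap.comp (mulT k V G) :=
    TensorProduct.ext' fun x y => by
      have hx : ∀ x, F (QSym.ι b q x) = toH b q κ (vec G x) := fun x => by
        rw [← hfι]
        exact RingQuot.liftAlgHom_mkAlgHom_apply k f hf _
      rw [LinearMap.comp_apply, LinearMap.comp_apply, mulS_tmul, mulT_tmul,
        AlgHom.toLinearMap_apply, AlgHom.toLinearMap_apply, map_mul, map_mul, hx, hx]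
  have hX : toH b q κ (mulT k V G X) = 0 := by
    have := LinearMap.congr_fun hF X
    rw [LinearMap.comp_apply, h, map_zero] at this
    exact this.symm
  refine mem_qext_of_toH (X := fun _ => X) (Y := fun _ => 0) hq hq1 hP ?_ 1
  rw [map_sum]
  refine Finset.sum_eq_zero fun g _ => ?_
  rw [map_mul, map_zero, add_zero, hX, zero_mul]

end Trivial

/-- The quadratic relations of the quantum symmetric algebra are the quantum antisymmetric
tensors. That there are no others follows from the PBW property of `H_{q,0}` for the trivial
group. -/
theorem mulS_eq_zero_iff (h2 : (2 : k) ≠ 0) (hq : ∀ i j, q i j * q j i = 1)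
    (hq1 : ∀ i, q i i = 1) {X : V ⊗[k] V} : mulS b q X = 0 ↔ X ∈ qext b q := by
  constructor
  · exact mem_qext_of_mulS_eq_zero (G := (⊥ : Subgroup (V ≃ₗ[k] V))) hq hq1 rfl
      (isQuantumDrinfeldOrbifold_zero h2 hq hq1 rfl)
  · intro h
    have h' := mulS_qswap (b := b) (q := q) X
    rw [mem_qext.1 h, map_neg] at h'
    have : (2 : k) • mulS b q X = 0 := by
      rw [two_smul]
      nth_rw 1 [← h']
      exact neg_add_cancel _
    exact (smul_eq_zero.1 this).resolve_left h2

variable {G : Type w} [Group G] [DistribMulAction G V] [SMulCommClass G k V]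

theorem preservesQExt_of_actsOnQSym (h2 : (2 : k) ≠ 0) (hq : ∀ i j, q i j * q j i = 1)
    (hq1 : ∀ i, q i i = 1) (hact : ActsOnQSym G b q) : PreservesQExt G b q := by
  obtain ⟨Φ, hΦ⟩ := hact
  intro h X hX
  rw [← mulS_eq_zero_iff h2 hq hq1] at hX ⊢
  have : (Φ h).toLinearMap.comp (mulS b q) = (mulS b q).comp (actT k V h) :=
    TensorProduct.ext' fun x y => by
      simp [hΦ]
  have e := LinearMap.congr_fun this X
  rw [LinearMap.comp_apply, hX, map_zero] at e
  exact e.symm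

end QSym

/-! ### The conditions in coordinates -/

section Coordinates

variable {k : Type u} {V : Type v} {G : Type w} [Field k] [AddCommGroup V] [Module k V]
  [Group G] [Fintype G] [DistribMulAction G V] [SMulCommClass G k V] {n : ℕ}
  {b : Module.Basis (Fin n) k V} {q : Fin n → Fin n → k}
  {κ : V →ₗ[k] V →ₗ[k] (k × V) ⊗[k] MonoidAlgebra k G}

/-- A symmetric double sum with zero diagonal is twice its part below the diagonal. -/
theorem sum_eq_two_smul {M : Type*} [AddCommGroup M] [Module k M] (f : Fin n → Fin n → M)
    (hs : ∀ l m, f l m = f m l) (hd : ∀ l, f l l = 0) :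
    ∑ l, ∑ m, f l m = (2 : k) • ∑ m, ∑ l, if m < l then f l m else 0 := by
  have e : ∀ l m, f l m = (if m < l then f l m else 0) + (if l < m then f m l else 0) := by
    intro l m
    rcases lt_trichotomy l m with h | rfl | h
    · simp [h, h.not_gt, hs l m]
    · simp [hd]
    · simp [h, h.not_gt]
  calc ∑ l, ∑ m, f l m
      = ∑ l, ∑ m, ((if m < l then f l m else 0) + (if l < m then f m l else 0)) :=
        Finset.sum_congr rfl fun l _ => Finset.sum_congr rfl fun m _ => e l m
    _ = _ := by
        simp only [Finset.sum_add_distrib]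
        rw [Finset.sum_comm, two_smul]

theorem kap_basis_swap (hκ : ∀ i j, κ (b i) (b j) = -(q i j • κ (b j) (b i))) (g : G)
    (i j : Fin n) : kap κ g (b i ⊗ₜ b j) = -(q i j • kap κ g (b j ⊗ₜ b i)) := by
  simp only [kap, LinearMap.comp_apply, TensorProduct.lift.tmul]
  rw [hκ i j, map_neg, map_smul]

theorem kap_diag (h2 : (2 : k) ≠ 0) (hq1 : ∀ i, q i i = 1)
    (hκ : ∀ i j, κ (b i) (b j) = -(q i j • κ (b j) (b i))) (g : G) (i : Fin n) :
    kap κ g (b i ⊗ₜ b i) = 0 := by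
  have h := kap_basis_swap hκ g i i
  rw [hq1, one_smul, eq_neg_iff_add_eq_zero, ← two_smul k] at h
  exact (smul_eq_zero.1 h).resolve_left h2

/-- On a quantum antisymmetric tensor, `κ_g` is determined by the coordinates below the
diagonal. -/
theorem kap_of_mem_qext (h2 : (2 : k) ≠ 0) (hq : ∀ i j, q i j * q j i = 1)
    (hq1 : ∀ i, q i i = 1) (hκ : ∀ i j, κ (b i) (b j) = -(q i j • κ (b j) (b i))) (g : G)
    {X : V ⊗[k] V} (hX : X ∈ qext b q) :
    kap κ g X = (2 : k) • ∑ m, ∑ l, if m < l then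
      (b.tensorProduct b).repr X (l, m) • kap κ g (b l ⊗ₜ b m) else 0 := by
  rw [← sum_eq_two_smul (k := k)
    (fun l m => (b.tensorProduct b).repr X (l, m) • kap κ g (b l ⊗ₜ b m))]
  · conv_lhs => rw [← (b.tensorProduct b).sum_repr X, map_sum, Fintype.sum_prod_type]
    simp
  · intro l m
    have h := congrArg (fun Y => (b.tensorProduct b).repr Y (l, m)) (mem_qext.1 hX)
    simp only [repr_qswap, map_neg, Finsupp.neg_apply] at h
    rw [← neg_eq_iff_eq_neg.2 h, kap_basis_swap hκ g l m, smul_neg, smul_smul, neg_mul, neg_smul,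
      neg_neg, mul_right_comm, hq, one_mul]
  · intro l
    rw [kap_diag h2 hq1 hκ, smul_zero]

/-- The quantum minors are the coordinates of the transformed relation
`h • (v_j ⊗ v_i - q_{ji} v_i ⊗ v_j)`. -/
theorem repr_actT (i j l m : Fin n) (h : G) :
    (b.tensorProduct b).repr (actT k V h (b j ⊗ₜ b i - qswap b q (b j ⊗ₜ b i))) (l, m) =
      qdet b q i j m l h := by
  simp [qdet, coef, Module.Basis.tensorProduct_repr_tmul_apply, mul_comm]

/-- The invariance of `κ` at the relation of `v_j` and `v_i`. -/
theorem kappaInvariant_basis_iff (h2 : (2 : k) ≠ 0) (hq : ∀ i j, q i j * q j i = 1)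
    (hq1 : ∀ i, q i i = 1) (hκ : ∀ i j, κ (b i) (b j) = -(q i j • κ (b j) (b i)))
    (hext : PreservesQExt G b q) (g h : G) (i j : Fin n) :
    kap κ (h * g * h⁻¹) (actT k V h (b j ⊗ₜ b i - qswap b q (b j ⊗ₜ b i))) =
        actLow k V h (kap κ g (b j ⊗ₜ b i - qswap b q (b j ⊗ₜ b i))) ↔
      kappaC κ g (b j) (b i) =
          ∑ m, ∑ l, (if m < l then
            qdet b q i j m l h * kappaC κ (h * g * h⁻¹) (b l) (b m) else 0) ∧
        h • kappaL κ g (b j) (b i) =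
          ∑ m, ∑ l, (if m < l then
            qdet b q i j m l h • kappaL κ (h * g * h⁻¹) (b l) (b m) else 0) := by
  rw [kap_of_mem_qext h2 hq hq1 hκ _ (hext h _ (sub_qswap_mem_qext hq _))]
  simp only [repr_actT]
  rw [map_sub (kap κ g), kap_qswap hκ, sub_neg_eq_add, ← two_smul k, map_smul,
    (smul_right_injective (k × V) h2).eq_iff, Prod.ext_iff, eq_comm, eq_comm (b := (actLow k V h
      (kap κ g (b j ⊗ₜ b i))).2)]
  simp only [Prod.fst_sum, Prod.snd_sum, apply_ite Prod.fst, apply_ite Prod.snd, Prod.smul_fst,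
    Prod.smul_snd, Prod.fst_zero, Prod.snd_zero, actLow_apply, kap_tmul, smul_eq_mul]

/-- Invariance on `qext` needs to be tested only on the relations of `v_j` and `v_i` with `i < j`. -/
theorem kappaInvariant_iff (h2 : (2 : k) ≠ 0) (hq : ∀ i j, q i j * q j i = 1)
    (hq1 : ∀ i, q i i = 1) (hκ : ∀ i j, κ (b i) (b j) = -(q i j • κ (b j) (b i)))
    (hext : PreservesQExt G b q) :
    KappaInvariant b q κ ↔ ∀ (g h : G) (i j : Fin n), i < j →
      kappaC κ g (b j) (b i) =
          ∑ m, ∑ l, (if m < l then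
            qdet b q i j m l h * kappaC κ (h * g * h⁻¹) (b l) (b m) else 0) ∧
        h • kappaL κ g (b j) (b i) =
          ∑ m, ∑ l, (if m < l then
            qdet b q i j m l h • kappaL κ (h * g * h⁻¹) (b l) (b m) else 0) := by
  constructor
  · intro hinv g h i j _
    exact (kappaInvariant_basis_iff h2 hq hq1 hκ hext g h i j).1
      (hinv g h _ (sub_qswap_mem_qext hq _))
  · intro H g h X hX
    have hlt : ∀ {i j : Fin n}, i < j →
        kap κ (h * g * h⁻¹) (actT k V h (b j ⊗ₜ b i - qswap b q (b j ⊗ₜ b i))) =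
          actLow k V h (kap κ g (b j ⊗ₜ b i - qswap b q (b j ⊗ₜ b i))) :=
      fun {i j} hij => (kappaInvariant_basis_iff h2 hq hq1 hκ hext g h i j).2 (H g h i j hij)
    have hst : ∀ s t, kap κ (h * g * h⁻¹) (actT k V h (b s ⊗ₜ b t - qswap b q (b s ⊗ₜ b t))) =
        actLow k V h (kap κ g (b s ⊗ₜ b t - qswap b q (b s ⊗ₜ b t))) := fun s t => by
      rcases lt_trichotomy s t with hst | rfl | hst
      · have e : b s ⊗ₜ[k] b t - qswap b q (b s ⊗ₜ b t) =
            -(q s t • (b t ⊗ₜ b s - qswap b q (b t ⊗ₜ b s))) := by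
          simp [smul_sub, smul_smul, hq]
        rw [e]
        simp only [map_neg, map_smul, hlt hst]
      · rw [qswap_basis, hq1, one_smul, sub_self]
        simp only [map_zero]
      · exact hlt hst
    have key : (kap κ (h * g * h⁻¹)).comp ((actT k V h).comp (LinearMap.id - qswap b q)) =
        (actLow k V h).comp ((kap κ g).comp (LinearMap.id - qswap b q)) :=
      tensor_hom_ext b hst
    have e := LinearMap.congr_fun key X
    simp only [LinearMap.comp_apply, LinearMap.sub_apply, LinearMap.id_apply, mem_qext.1 hX,
      sub_neg_eq_add, ← two_smul k X, map_smul] at e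
    exact smul_right_injective (k × V) h2 e

theorem overlapQuad_mem_iff (h2 : (2 : k) ≠ 0) (hq : ∀ i j, q i j * q j i = 1)
    (hq1 : ∀ i, q i i = 1) (i j m : Fin n) (g : G) :
    overlapQuad b q κ i j m g ∈ qext b q ↔
      (q j i * q m i) • (QSym.ι b q (b i) * QSym.ι b q (kappaL κ g (b m) (b j)))
            - QSym.ι b q (kappaL κ g (b m) (b j)) * QSym.ι b q (g • b i)
            - q m j • (QSym.ι b q (b j) * QSym.ι b q (kappaL κ g (b m) (b i)))
            + q j i • (QSym.ι b q (kappaL κ g (b m) (b i)) * QSym.ι b q (g • b j))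
            + QSym.ι b q (b m) * QSym.ι b q (kappaL κ g (b j) (b i))
            - (q m i * q m j) •
              (QSym.ι b q (kappaL κ g (b j) (b i)) * QSym.ι b q (g • b m)) = 0 := by
  rw [← mulS_eq_zero_iff h2 hq hq1]
  have e : ∀ X Y, mulS b q (X - Y) = mulS b q X - mulS b q Y := fun X Y => map_sub (mulS b q) X Y
  simp only [overlapQuad, e, map_add, map_smul, mulS_tmul]

/-- The quadratic part of an overlap, normalized by `q_{ij} q_{im} q_{jm}` and written in the
cyclic order of the indices. -/
theorem smul_overlapQuad (hq0 : ∀ i j, q i j ≠ 0) (hqinv : ∀ i j, q j i = (q i j)⁻¹)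
    (hκ : ∀ i j, κ (b i) (b j) = -(q i j • κ (b j) (b i))) (i j m : Fin n) (h : G) :
    (q i j * q i m * q j m) • overlapQuad b q κ i j m h =
      (q i j * q i m) • kappaL κ h (b j) (b m) ⊗ₜ[k] (h • b i)
        - b i ⊗ₜ[k] kappaL κ h (b j) (b m)
        + (q i m * q j m) • kappaL κ h (b m) (b i) ⊗ₜ[k] (h • b j)
        - (q i j * q i m) • b j ⊗ₜ[k] kappaL κ h (b m) (b i)
        + kappaL κ h (b i) (b j) ⊗ₜ[k] (h • b m)
        - (q i m * q j m) • b m ⊗ₜ[k] kappaL κ h (b i) (b j) := by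
  have hL : ∀ s t, kappaL κ h (b s) (b t) = -(q s t • kappaL κ h (b t) (b s)) := fun s t =>
    congrArg Prod.snd (kap_basis_swap hκ h s t)
  have := hq0 i j
  have := hq0 i m
  have := hq0 j m
  rw [overlapQuad, hL m j, hL j i, hqinv i j, hqinv i m, hqinv j m]
  simp only [TensorProduct.tmul_neg, TensorProduct.neg_tmul, TensorProduct.tmul_smul,
    ← TensorProduct.smul_tmul']
  match_scalars <;> field_simp

theorem smul_overlapLin (hq0 : ∀ i j, q i j ≠ 0) (hqinv : ∀ i j, q j i = (q i j)⁻¹)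
    (hκ : ∀ i j, κ (b i) (b j) = -(q i j • κ (b j) (b i))) (i j m : Fin n) (g : G) :
    (q i j * q i m * q j m) • (overlapLin b q κ i j m g).2 =
      -(kappaC κ g (b j) (b m) • (b i - (q i j * q i m) • (g • b i))
        + kappaC κ g (b m) (b i) • ((q i j * q i m) • b j - (q i m * q j m) • (g • b j))
        + kappaC κ g (b i) (b j) • ((q i m * q j m) • b m - g • b m)) := by
  have hC : ∀ s t, kappaC κ g (b s) (b t) = -(q s t * kappaC κ g (b t) (b s)) := fun s t =>
    congrArg Prod.fst (kap_basis_swap hκ g s t)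
  have := hq0 i j
  have := hq0 i m
  have := hq0 j m
  rw [overlapLin, hC m j, hC j i, hqinv i j, hqinv i m, hqinv j m]
  generalize g • b i = x, g • b j = y, g • b m = z
  match_scalars <;> field_simp

theorem overlapRem_eq_zero_iff (hq0 : ∀ i j, q i j ≠ 0) (hqinv : ∀ i j, q j i = (q i j)⁻¹)
    (hκ : ∀ i j, κ (b i) (b j) = -(q i j • κ (b j) (b i))) (i j m : Fin n) (g : G) :
    overlapRem b q κ i j m g = 0 ↔
      ∑ h : G,
            ((q i j * q i m) • kappaL κ (g * h⁻¹) (kappaL κ h (b j) (b m)) (h • b i)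
              - kappaL κ (g * h⁻¹) (b i) (kappaL κ h (b j) (b m))
              + (q i m * q j m) • kappaL κ (g * h⁻¹) (kappaL κ h (b m) (b i)) (h • b j)
              - (q i j * q i m) • kappaL κ (g * h⁻¹) (b j) (kappaL κ h (b m) (b i))
              + kappaL κ (g * h⁻¹) (kappaL κ h (b i) (b j)) (h • b m)
              - (q i m * q j m) • kappaL κ (g * h⁻¹) (b m) (kappaL κ h (b i) (b j))) =
          (2 : k) •
            (kappaC κ g (b j) (b m) • (b i - (q i j * q i m) • (g • b i))
              + kappaC κ g (b m) (b i) • ((q i j * q i m) • b j - (q i m * q j m) • (g • b j))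
              + kappaC κ g (b i) (b j) • ((q i m * q j m) • b m - g • b m)) ∧
        ∑ h : G,
            ((q i j * q i m) * kappaC κ (g * h⁻¹) (kappaL κ h (b j) (b m)) (h • b i)
              - kappaC κ (g * h⁻¹) (b i) (kappaL κ h (b j) (b m))
              + (q i m * q j m) * kappaC κ (g * h⁻¹) (kappaL κ h (b m) (b i)) (h • b j)
              - (q i j * q i m) * kappaC κ (g * h⁻¹) (b j) (kappaL κ h (b m) (b i))
              + kappaC κ (g * h⁻¹) (kappaL κ h (b i) (b j)) (h • b m)
              - (q i m * q j m) * kappaC κ (g * h⁻¹) (b m) (kappaL κ h (b i) (b j))) = 0 := by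
  have hM : q i j * q i m * q j m ≠ 0 := mul_ne_zero (mul_ne_zero (hq0 _ _) (hq0 _ _)) (hq0 _ _)
  rw [← smul_right_injective (k × V) hM |>.eq_iff, smul_zero, overlapRem, smul_add,
    Finset.smul_sum]
  simp only [← map_smul, smul_overlapQuad hq0 hqinv hκ]
  rw [Prod.ext_iff, and_comm]
  simp only [map_sub, map_add, map_smul, kap_tmul, Prod.fst_add, Prod.snd_add, Prod.fst_sum,
    Prod.snd_sum, Prod.fst_sub, Prod.snd_sub, Prod.smul_fst, Prod.smul_snd, smul_eq_mul,
    Prod.fst_zero, Prod.snd_zero]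
  refine and_congr ?_ ?_
  · rw [smul_comm, smul_overlapLin hq0 hqinv hκ, smul_neg, ← sub_eq_add_neg, sub_eq_zero]
  · simp [overlapLin]

end Coordinates

end QuantumDrinfeld

end

open QuantumDrinfeld in
theorem theorem2p2 {k V G : Type*} [Field k] (h2 : (2 : k) ≠ 0) [AddCommGroup V] [Module k V]
    [Group G] [Fintype G] [DistribMulAction G V] [SMulCommClass G k V] {n : ℕ}
    (b : Module.Basis (Fin n) k V) (q : Fin n → Fin n → k)
    (hq0 : ∀ i j, q i j ≠ 0) (hq1 : ∀ i, q i i = 1) (hqinv : ∀ i j, q j i = (q i j)⁻¹)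
    (hact : ActsOnQSym G b q)
    (κ : V →ₗ[k] V →ₗ[k] (k × V) ⊗[k] MonoidAlgebra k G)
    (hκ : ∀ i j, κ (b i) (b j) = -(q i j • κ (b j) (b i))) :
    IsQuantumDrinfeldOrbifold b q κ ↔
      -- invariance of the constant and linear parts under `G`
      (∀ (g h : G) (i j : Fin n), i < j →
        kappaC κ g (b j) (b i) =
            ∑ m, ∑ l, (if m < l then
              qdet b q i j m l h * kappaC κ (h * g * h⁻¹) (b l) (b m) else 0) ∧
          h • kappaL κ g (b j) (b i) =
            ∑ m, ∑ l, (if m < l then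
              qdet b q i j m l h • kappaL κ (h * g * h⁻¹) (b l) (b m) else 0)) ∧
      (∀ (i j m : Fin n), i ≠ j → i ≠ m → j ≠ m → ∀ g : G,
        -- quantum commutation, an identity in the quantum symmetric algebra
        (q j i * q m i) • (QSym.ι b q (b i) * QSym.ι b q (kappaL κ g (b m) (b j)))
            - QSym.ι b q (kappaL κ g (b m) (b j)) * QSym.ι b q (g • b i)
            - q m j • (QSym.ι b q (b j) * QSym.ι b q (kappaL κ g (b m) (b i)))
            + q j i • (QSym.ι b q (kappaL κ g (b m) (b i)) * QSym.ι b q (g • b j))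
            + QSym.ι b q (b m) * QSym.ι b q (kappaL κ g (b j) (b i))
            - (q m i * q m j) •
              (QSym.ι b q (kappaL κ g (b j) (b i)) * QSym.ι b q (g • b m)) = 0 ∧
        -- Jacobi-type identity for the linear part
        ∑ h : G,
            ((q i j * q i m) • kappaL κ (g * h⁻¹) (kappaL κ h (b j) (b m)) (h • b i)
              - kappaL κ (g * h⁻¹) (b i) (kappaL κ h (b j) (b m))
              + (q i m * q j m) • kappaL κ (g * h⁻¹) (kappaL κ h (b m) (b i)) (h • b j)
              - (q i j * q i m) • kappaL κ (g * h⁻¹) (b j) (kappaL κ h (b m) (b i))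
              + kappaL κ (g * h⁻¹) (kappaL κ h (b i) (b j)) (h • b m)
              - (q i m * q j m) • kappaL κ (g * h⁻¹) (b m) (kappaL κ h (b i) (b j))) =
          (2 : k) •
            (kappaC κ g (b j) (b m) • (b i - (q i j * q i m) • (g • b i))
              + kappaC κ g (b m) (b i) • ((q i j * q i m) • b j - (q i m * q j m) • (g • b j))
              + kappaC κ g (b i) (b j) • ((q i m * q j m) • b m - g • b m)) ∧
        -- Jacobi-type identity for the constant part
        ∑ h : G,
            ((q i j * q i m) * kappaC κ (g * h⁻¹) (kappaL κ h (b j) (b m)) (h • b i)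
              - kappaC κ (g * h⁻¹) (b i) (kappaL κ h (b j) (b m))
              + (q i m * q j m) * kappaC κ (g * h⁻¹) (kappaL κ h (b m) (b i)) (h • b j)
              - (q i j * q i m) * kappaC κ (g * h⁻¹) (b j) (kappaL κ h (b m) (b i))
              + kappaC κ (g * h⁻¹) (kappaL κ h (b i) (b j)) (h • b m)
              - (q i m * q j m) * kappaC κ (g * h⁻¹) (b m) (kappaL κ h (b i) (b j))) = 0) := by
  have hq : ∀ i j, q i j * q j i = 1 := fun i j => by rw [hqinv i j, mul_inv_cancel₀ (hq0 i j)]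
  have hext := preservesQExt_of_actsOnQSym h2 hq hq1 hact
  rw [isQuantumDrinfeldOrbifold_iff h2 hq hq1 hκ hext, kappaInvariant_iff h2 hq hq1 hκ hext]
  refine and_congr_right fun _ => ⟨fun ⟨hquad, hrem⟩ i j m hij him hjm g => ?_, fun H =>
    ⟨fun i j m hij him hjm g => ?_, fun i j m hij him hjm g => ?_⟩⟩
  · exact ⟨(overlapQuad_mem_iff h2 hq hq1 i j m g).1 (hquad i j m hij him hjm g),
      (overlapRem_eq_zero_iff hq0 hqinv hκ i j m g).1 (hrem i j m hij him hjm g)⟩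
  · exact (overlapQuad_mem_iff h2 hq hq1 i j m g).2 (H i j m hij him hjm g).1
  · exact (overlapRem_eq_zero_iff hq0 hqinv hκ i j m g).2 (H i j m hij him hjm g).2
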